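/- Let $\mu_0\in\mathcal P(\mathbb R^{d_0})$ and $\mu_1\in\mathcal P(\mathbb R^{d_1})$ be compactly supported Borel probability measures and let $\varepsilon>0$. For $A\in\mathbb R^{d_0\times d_1}$ let $$\mathsf{OT}_{A,\varepsilon}(\mu_0,\mu_1)=\inf_{\pi\in\Pi(\mu_0,\mu_1)}\int\left(-4\|x\|^2\|y\|^2-32\,x^{\intercal}Ay\right)d\pi(x,y)+\varepsilon\,\mathsf D_{\mathsf{KL}}(\pi\|\mu_0\otimes\mu_1),$$ where $\Pi(\mu_0,\mu_1)$ is the set of couplings of $\mu_0$ and $\mu_1$ and $\mathsf D_{\mathsf{KL}}$ is the Kullback–Leibler divergence, and let $\Phi(A)=32\|A\|_F^2+\mathsf{OT}_{A,\varepsilon}(\mu_0,\mu_1)$, where $\|\cdot\|_F$ is the Frobenius norm. Write $M_4(\mu)=\int\|x\|^4\,d\mu(x)$ and $\mathcal D_M=\{A\in\mathbb R^{d_0\times d_1}:\|A\|_F\le M/2\}$. Then $\Phi$ is real-valued and twice continuously differentiable on $\mathbb R^{d_0\times d_1}$, and: 1. $\Phi$ is weakly convex with parameter at most $\rho=32^2\varepsilon^{-1}\sqrt{M_4(\mu_0)M_4(\mu_1)}-64$,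 that is, $\Phi+\frac{\rho}{2}\|\cdot\|_F^2$ is convex on $\mathbb R^{d_0\times d_1}$ for this $\rho$ (which may be negative). 2. If $\sqrt{M_4(\mu_0)M_4(\mu_1)}<\varepsilon/16$, then $\Phi$ is strictly convex on $\mathbb R^{d_0\times d_1}$ and has a unique minimizer there. 3. For every $M>0$, $\Phi$ is $L$-smooth on $\mathcal D_M$, that is, $\|\nabla\Phi(A)-\nabla\Phi(B)\|_F\le L\|A-B\|_F$ for all $A,B\in\mathcal D_M$, with $$L=\max_{A\in\mathcal D_M}\ \lambda_{\max}\left(D^2\Phi_{[A]}\right)\vee\left(-\lambda_{\min}\left(D^2\Phi_{[A]}\right)\right)\ \le\ 64\vee\left(32^2\varepsilon^{-1}\sqrt{M_4(\mu_0)M_4(\mu_1)}-64\right),$$ where the maximum is attained and $\lambda_{\max}(D^2\Phi_{[A]})$, $\lambda_{\min}(D^2\Phi_{[A]})$ are the largest and smallest eigenvalues of the symmetric bilinear form $D^2\Phi_{[A]}$ (the Hessian of $\Phi$ at $A$) with respect to the Frobenius inner product. -/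

import Mathlib

open MeasureTheory InformationTheory Set

noncomputable section

/-- The space `ℝ^{d₀ × d₁}` of real matrices with the Frobenius inner product
`⟨A, B⟩_F = Tr(Aᵀ B) = ∑ i j, A (i, j) * B (i, j)` and the Frobenius norm. -/
abbrev FrobMatrix (d₀ d₁ : ℕ) : Type := EuclideanSpace ℝ (Fin d₀ × Fin d₁)

/-- The set `Π(μ₀, μ₁)` of couplings of `μ₀` and `μ₁`: the measures on the product with these
marginals. -/
def couplings {X Y : Type*} [MeasurableSpace X] [MeasurableSpace Y]
    (μ₀ : Measure X) (μ₁ : Measure Y) : Set (Measure (X × Y)) :=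
  {π | π.fst = μ₀ ∧ π.snd = μ₁}

/-- The entropic optimal transport problem with cost `c` and regularization parameter `ε`:
the infimum over all couplings `π` of `∫ c dπ + ε KL(π ‖ μ₀ ⊗ μ₁)`, as an extended real. -/
def entropicOT {X Y : Type*} [MeasurableSpace X] [MeasurableSpace Y]
    (c : X → Y → ℝ) (ε : ℝ) (μ₀ : Measure X) (μ₁ : Measure Y) : EReal :=
  ⨅ π ∈ couplings μ₀ μ₁,
    ((∫ z, c z.1 z.2 ∂π : ℝ) : EReal) + (ε : EReal) * (klDiv π (μ₀.prod μ₁) : EReal)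

/-- The cost `c_A(x, y) = -4 ‖x‖² ‖y‖² - 32 xᵀ A y`. -/
def costMatrix {d₀ d₁ : ℕ} (A : FrobMatrix d₀ d₁)
    (x : EuclideanSpace ℝ (Fin d₀)) (y : EuclideanSpace ℝ (Fin d₁)) : ℝ :=
  -4 * ‖x‖ ^ 2 * ‖y‖ ^ 2 - 32 * ∑ i, ∑ j, x i * A (i, j) * y j

/-- The problem `OT_{A,ε}(μ₀, μ₁)`: entropic optimal transport with cost `c_A`. -/
def matrixOT {d₀ d₁ : ℕ} (ε : ℝ) (μ₀ : Measure (EuclideanSpace ℝ (Fin d₀)))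
    (μ₁ : Measure (EuclideanSpace ℝ (Fin d₁))) (A : FrobMatrix d₀ d₁) : EReal :=
  entropicOT (costMatrix A) ε μ₀ μ₁

/-- The objective `Φ(A) = 32 ‖A‖_F² + OT_{A,ε}(μ₀, μ₁)`. -/
def objective {d₀ d₁ : ℕ} (ε : ℝ) (μ₀ : Measure (EuclideanSpace ℝ (Fin d₀)))
    (μ₁ : Measure (EuclideanSpace ℝ (Fin d₁))) (A : FrobMatrix d₀ d₁) : ℝ :=
  32 * ‖A‖ ^ 2 + (matrixOT ε μ₀ μ₁ A).toReal

/-- The fourth moment `M₄(μ) = ∫ ‖x‖⁴ dμ(x)`. -/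
def fourthMoment {d : ℕ} (μ : Measure (EuclideanSpace ℝ (Fin d))) : ℝ :=
  ∫ x, ‖x‖ ^ 4 ∂μ

/-- The ball `D_M = {A : ‖A‖_F ≤ M / 2}`. -/
def frobBall (d₀ d₁ : ℕ) (M : ℝ) : Set (FrobMatrix d₀ d₁) :=
  {A | ‖A‖ ≤ M / 2}

/-- `f` is `ρ`-weakly convex: `f + (ρ / 2) ‖·‖_F²` is convex. -/
def WeaklyConvex {d₀ d₁ : ℕ} (ρ : ℝ) (f : FrobMatrix d₀ d₁ → ℝ) : Prop :=
  ConvexOn ℝ univ (fun A => f A + ρ / 2 * ‖A‖ ^ 2)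

/-- `f` is `L`-smooth on `s`: it is differentiable at the points of `s` and its gradient is
`L`-Lipschitz on `s`, both for the Frobenius inner product. -/
def LSmoothOn {d₀ d₁ : ℕ} (L : ℝ) (f : FrobMatrix d₀ d₁ → ℝ) (s : Set (FrobMatrix d₀ d₁)) :
    Prop :=
  (∀ A ∈ s, DifferentiableAt ℝ f A) ∧
    ∀ A ∈ s, ∀ B ∈ s, ‖gradient f A - gradient f B‖ ≤ L * ‖A - B‖

/-- The second Fréchet derivative `D²f_[A](B, C)`. -/
def secondDeriv {d₀ d₁ : ℕ} (f : FrobMatrix d₀ d₁ → ℝ) (A B C : FrobMatrix d₀ d₁) : ℝ :=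
  fderiv ℝ (fderiv ℝ f) A B C

/-- The eigenvalues of the bilinear form `D²f_[A]` with respect to the Frobenius inner product,
i.e. the eigenvalues of the Hessian of `f` at `A`. -/
def hessianEigenvalues {d₀ d₁ : ℕ} (f : FrobMatrix d₀ d₁ → ℝ) (A : FrobMatrix d₀ d₁) : Set ℝ :=
  {l | ∃ B : FrobMatrix d₀ d₁, B ≠ 0 ∧ ∀ C, secondDeriv f A B C = l * inner ℝ B C}

/-- The largest eigenvalue of `D²f_[A]`. -/
def hessianMaxEigenvalue {d₀ d₁ : ℕ} (f : FrobMatrix d₀ d₁ → ℝ) (A : FrobMatrix d₀ d₁) : ℝ :=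
  sSup (hessianEigenvalues f A)

/-- The smallest eigenvalue of `D²f_[A]`. -/
def hessianMinEigenvalue {d₀ d₁ : ℕ} (f : FrobMatrix d₀ d₁ → ℝ) (A : FrobMatrix d₀ d₁) : ℝ :=
  sInf (hessianEigenvalues f A)

end

open BoundedContinuousFunction Filter Topology

/-!
The Schrödinger system of a bounded log-kernel `a` is solvable because the soft-min transforms
contract the oscillation. Its solutions are the maximisers of the dual problem, whose value `V a`
is the entropic transport cost in units of `ε`; the implicit function theorem, with a gauge
term removing the additive constants, makes `V` smooth. If `π` is the optimal plan at `a`, then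
`V a + 1 - ∫ exp w dπ ≤ V (a + w) ≤ V a - ∫ w dπ`, and both bounds touch `V` to first order at
`w = 0`, so `-∫ w² dπ ≤ D²V_[a](w, w) ≤ 0`. The cost `c_A` is affine in `A` and, on the compact
supports, agrees with a bounded kernel; `w` is then `32 ε⁻¹ ⟪B, x yᵀ⟫`, and Cauchy–Schwarz bounds
`∫ w² dπ` through the fourth moments of the marginals.
-/

namespace EntropicOT

section BoundedContinuous

variable {X Y : Type*} [TopologicalSpace X] [TopologicalSpace Y]

lemma exp_apply (f : X →ᵇ ℝ) (x : X) : NormedSpace.exp f x = Real.exp (f x) := by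
  rw [Real.exp_eq_exp_ℝ]
  exact NormedSpace.map_exp ((ContinuousMap.evalAlgHom ℝ ℝ x).comp (toContinuousMapₐ ℝ))
    (continuous_eval_const x) f

lemma integrable_exp [MeasurableSpace X] [OpensMeasurableSpace X] (f : X →ᵇ ℝ) (μ : Measure X)
    [IsFiniteMeasure μ] : Integrable (fun x => Real.exp (f x)) μ := by
  simpa only [funext (exp_apply f)] using (NormedSpace.exp f).integrable μ

/-- The function `φ ⊕ ψ : (x, y) ↦ φ x + ψ y`, linear in the pair `(φ, ψ)`. -/
noncomputable def directSum : (X →ᵇ ℝ) × (Y →ᵇ ℝ) →L[ℝ] (X × Y →ᵇ ℝ) :=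
  (compContinuousCLM ℝ ℝ ⟨Prod.fst, continuous_fst⟩).coprod
    (compContinuousCLM ℝ ℝ ⟨Prod.snd, continuous_snd⟩)

@[simp]
lemma directSum_apply (p : (X →ᵇ ℝ) × (Y →ᵇ ℝ)) (z : X × Y) :
    directSum p z = p.1 z.1 + p.2 z.2 := rfl

/-- The function `(y, x) ↦ h (x, y)`. -/
noncomputable def swap : (X × Y →ᵇ ℝ) →L[ℝ] (Y × X →ᵇ ℝ) :=
  compContinuousCLM ℝ ℝ ⟨Prod.swap, continuous_swap⟩

@[simp]
lemma swap_apply (h : X × Y →ᵇ ℝ) (z : Y × X) : swap h z = h z.swap := rfl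

lemma norm_swap (h : X × Y →ᵇ ℝ) : ‖swap h‖ = ‖h‖ :=
  le_antisymm
    ((norm_le (norm_nonneg h)).2 fun z => h.norm_coe_le_norm z.swap)
    ((norm_le (norm_nonneg (swap h))).2 fun z => (swap h).norm_coe_le_norm z.swap)

/-- The section `h (x, ·)`. -/
noncomputable def slice (h : X × Y →ᵇ ℝ) (x : X) : Y →ᵇ ℝ :=
  h.compContinuous ⟨fun y => (x, y), by fun_prop⟩

@[simp]
lemma slice_apply (h : X × Y →ᵇ ℝ) (x : X) (y : Y) : slice h x y = h (x, y) := rfl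

lemma norm_slice_le (h : X × Y →ᵇ ℝ) (x : X) : ‖slice h x‖ ≤ ‖h‖ :=
  (norm_le (norm_nonneg h)).2 fun y => h.norm_coe_le_norm (x, y)

section Mean

variable [MeasurableSpace Y] [OpensMeasurableSpace Y] (ν : Measure Y) [IsProbabilityMeasure ν]

/-- The mean `∫ f dν`, as a continuous linear functional of `f`. -/
noncomputable def mean : (Y →ᵇ ℝ) →L[ℝ] ℝ :=
  LinearMap.mkContinuous
    { toFun := fun f => ∫ y, f y ∂ν
      map_add' := fun f g => integral_add (f.integrable ν) (g.integrable ν)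
      map_smul' := fun c f => integral_const_mul c f } 1
    fun f => by simpa using f.norm_integral_le_norm ν

@[simp]
lemma mean_apply (f : Y →ᵇ ℝ) : mean ν f = ∫ y, f y ∂ν := rfl

lemma abs_mean_le (f : Y →ᵇ ℝ) : |mean ν f| ≤ ‖f‖ := f.norm_integral_le_norm ν

/-- The function `x ↦ ∫ h (x, y) dν(y)`, linear in `h`. -/
noncomputable def integrateSnd [FirstCountableTopology X] : (X × Y →ᵇ ℝ) →L[ℝ] (X →ᵇ ℝ) :=
  LinearMap.mkContinuous
    { toFun := fun h => ofNormedAddCommGroup (fun x => mean ν (slice h x))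
        (continuous_of_dominated (bound := fun _ => ‖h‖)
          (fun x => ((slice h x).integrable ν).aestronglyMeasurable)
          (fun x => .of_forall fun y => h.norm_coe_le_norm (x, y))
          (integrable_const _) (.of_forall fun y => by simp only [slice_apply]; fun_prop))
        ‖h‖ (fun x => (abs_mean_le ν _).trans (norm_slice_le h x))
      map_add' := fun f g => ext fun x => map_add (mean ν) (slice f x) (slice g x)
      map_smul' := fun c f => ext fun x => map_smul (mean ν) c (slice f x) } 1
    fun h => (norm_le (by positivity)).2 fun x =>
      ((abs_mean_le ν _).trans (norm_slice_le h x)).trans_eq (one_mul _).symm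

@[simp]
lemma integrateSnd_apply [FirstCountableTopology X] (h : X × Y →ᵇ ℝ) (x : X) :
    integrateSnd ν h x = ∫ y, h (x, y) ∂ν := rfl

/-- The function `x ↦ ∫ h (y, x) dν(y)`, linear in `h`. -/
noncomputable def integrateFst [FirstCountableTopology X] : (Y × X →ᵇ ℝ) →L[ℝ] (X →ᵇ ℝ) :=
  (integrateSnd ν).comp swap

@[simp]
lemma integrateFst_apply [FirstCountableTopology X] (h : Y × X →ᵇ ℝ) (x : X) :
    integrateFst ν h x = ∫ y, h (y, x) ∂ν := rfl

end Mean

end BoundedContinuous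

section Oscillation

variable {X : Type*} [TopologicalSpace X]

/-- The oscillation `sup f - inf f` of a bounded function. -/
noncomputable def osc (f : X →ᵇ ℝ) : ℝ := Metric.diam (range f)

lemma osc_nonneg (f : X →ᵇ ℝ) : 0 ≤ osc f := Metric.diam_nonneg

lemma dist_le_osc (f : X →ᵇ ℝ) (x x' : X) : dist (f x) (f x') ≤ osc f :=
  Metric.dist_le_diam_of_mem f.isBounded_range (mem_range_self x) (mem_range_self x')

lemma sub_le_osc (f : X →ᵇ ℝ) (x x' : X) : f x - f x' ≤ osc f :=
  (le_abs_self _).trans (dist_le_osc f x x')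

lemma osc_le {f : X →ᵇ ℝ} {C : ℝ} (hC : 0 ≤ C) (h : ∀ x x', f x - f x' ≤ C) : osc f ≤ C := by
  refine Metric.diam_le_of_forall_dist_le hC ?_
  rintro _ ⟨x, rfl⟩ _ ⟨x', rfl⟩
  exact abs_sub_le_iff.2 ⟨h x x', h x' x⟩

lemma osc_le_two_mul_norm (f : X →ᵇ ℝ) : osc f ≤ 2 * ‖f‖ :=
  osc_le (by positivity) fun x x' => (le_abs_self _).trans (f.dist_le_two_norm x x')

lemma norm_le_osc {f : X →ᵇ ℝ} {x₀ : X} (h : f x₀ = 0) : ‖f‖ ≤ osc f :=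
  (norm_le (osc_nonneg f)).2 fun x => by
    simpa only [h, dist_zero_right] using dist_le_osc f x x₀

lemma osc_sub_const (f : X →ᵇ ℝ) (c : ℝ) : osc (f - const X c) = osc f := by
  simp only [osc, Metric.diam, Metric.ediam, iSup_range, coe_sub, Pi.sub_apply, const_apply,
    edist_sub_right]

/-- A contraction of the oscillation seminorm has a fixed point modulo constants: a high
iterate of its normalisation at a base point contracts the supremum norm. -/
theorem exists_eq_add_const_of_osc_le [Nonempty X] {T : (X →ᵇ ℝ) → (X →ᵇ ℝ)} {r : ℝ}
    (hr₀ : 0 ≤ r) (hr₁ : r < 1) (hT : ∀ φ ψ, osc (T φ - T ψ) ≤ r * osc (φ - ψ)) :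
    ∃ (φ : X →ᵇ ℝ) (κ : ℝ), T φ = φ + const X κ := by
  obtain ⟨x₀⟩ := ‹Nonempty X›
  lift r to NNReal using hr₀
  let S : (X →ᵇ ℝ) → (X →ᵇ ℝ) := fun φ => T φ - const X (T φ x₀)
  have osc_iterate : ∀ (n : ℕ) φ ψ, osc (S^[n] φ - S^[n] ψ) ≤ r ^ n * osc (φ - ψ) := by
    intro n φ ψ
    induction n with
    | zero => simp
    | succ n ih =>
      have hS : S (S^[n] φ) - S (S^[n] ψ) =
          T (S^[n] φ) - T (S^[n] ψ) - const X (T (S^[n] φ) x₀ - T (S^[n] ψ) x₀) :=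
        ext fun x => sub_sub_sub_comm _ _ _ _
      rw [Function.iterate_succ_apply', Function.iterate_succ_apply', hS, osc_sub_const,
        pow_succ', mul_assoc]
      exact (hT _ _).trans (mul_le_mul_of_nonneg_left ih r.2)
  obtain ⟨n, hn⟩ := exists_pow_lt_of_lt_one (by norm_num : (0 : ℝ) < 1 / 2) hr₁
  have hcontr : ContractingWith (2 * r ^ (n + 1)) S^[n + 1] := by
    refine ⟨?_, LipschitzWith.of_dist_le_mul fun φ ψ => ?_⟩
    · rw [← NNReal.coe_lt_coe]
      push_cast
      rw [pow_succ]
      nlinarith [pow_nonneg r.2 n]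
    · have hx₀ : (S^[n + 1] φ - S^[n + 1] ψ) x₀ = 0 := by
        simp [S, Function.iterate_succ_apply']
      rw [dist_eq_norm, dist_eq_norm]
      calc ‖S^[n + 1] φ - S^[n + 1] ψ‖ ≤ r ^ (n + 1) * osc (φ - ψ) :=
            (norm_le_osc hx₀).trans (osc_iterate _ φ ψ)
        _ ≤ r ^ (n + 1) * (2 * ‖φ - ψ‖) := by gcongr; exact osc_le_two_mul_norm _
        _ = 2 * r ^ (n + 1) * ‖φ - ψ‖ := by ring
  have hfix : S _ = _ := hcontr.isFixedPt_fixedPoint_iterate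
  exact ⟨_, _, sub_eq_iff_eq_add.1 hfix⟩

end Oscillation

section ExponentialTilting

variable {Y : Type*} [TopologicalSpace Y] [MeasurableSpace Y] [OpensMeasurableSpace Y]

lemma integral_exp_le_exp_mul {ν : Measure Y} [IsFiniteMeasure ν] {f g : Y →ᵇ ℝ} {c : ℝ}
    (h : ∀ y, f y ≤ g y + c) :
    ∫ y, Real.exp (f y) ∂ν ≤ Real.exp c * ∫ y, Real.exp (g y) ∂ν := by
  rw [← integral_const_mul]
  refine integral_mono (integrable_exp f ν) ((integrable_exp g ν).const_mul _) fun y => ?_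
  simpa only [← Real.exp_add, add_comm c] using Real.exp_le_exp.2 (h y)

lemma abs_log_integral_exp_le (ν : Measure Y) [IsProbabilityMeasure ν] (f : Y →ᵇ ℝ) :
    |Real.log (∫ y, Real.exp (f y) ∂ν)| ≤ ‖f‖ := by
  have hpos : 0 < ∫ y, Real.exp (f y) ∂ν := integral_exp_pos (integrable_exp f ν)
  have hle : ∫ y, Real.exp (f y) ∂ν ≤ Real.exp ‖f‖ := by
    simpa using integral_exp_le_exp_mul (ν := ν) (g := 0) fun y => by
      simpa using f.apply_le_norm y
  have hge : 1 ≤ Real.exp ‖f‖ * ∫ y, Real.exp (f y) ∂ν := by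
    simpa using integral_exp_le_exp_mul (ν := ν) (f := 0) (g := f) fun y => by
      simpa [neg_le_iff_add_nonneg] using f.neg_norm_le_apply y
  rw [abs_le, Real.le_log_iff_exp_le hpos, Real.log_le_iff_le_exp hpos, Real.exp_neg]
  exact ⟨(inv_le_iff_one_le_mul₀' (Real.exp_pos _)).2 hge, hle⟩

lemma smul_tilted_le_tilted (ν : Measure Y) [IsProbabilityMeasure ν] {f g : Y →ᵇ ℝ} {C : ℝ}
    (h : ‖f - g‖ ≤ C) :
    (Real.exp (-(2 * C))).toNNReal • ν.tilted f ≤ ν.tilted g := by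
  have hfg : ∀ y, |f y - g y| ≤ C := fun y => ((f - g).norm_coe_le_norm y).trans h
  have hf := integral_exp_pos (integrable_exp f ν)
  have hg := integral_exp_pos (integrable_exp g ν)
  have hgf := integral_exp_le_exp_mul (ν := ν) (f := g) (g := f) (c := C) fun y => by
    linarith [neg_le_of_abs_le (hfg y)]
  rw [ENNReal.smul_def, Measure.tilted, ← withDensity_smul' _ _ ENNReal.coe_ne_top]
  refine withDensity_mono (.of_forall fun y => ?_)
  rw [Pi.smul_apply, smul_eq_mul, ← ENNReal.ofReal, ← ENNReal.ofReal_mul (Real.exp_pos _).le]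
  refine ENNReal.ofReal_le_ofReal ?_
  rw [mul_div_assoc', div_le_div_iff₀ hf hg]
  calc Real.exp (-(2 * C)) * Real.exp (f y) * ∫ y, Real.exp (g y) ∂ν
      ≤ Real.exp (-(2 * C)) * (Real.exp (g y + C)) *
          (Real.exp C * ∫ y, Real.exp (f y) ∂ν) := by
        gcongr
        linarith [le_of_abs_le (hfg y)]
    _ = Real.exp (g y) * ∫ y, Real.exp (f y) ∂ν := by
        rw [← mul_assoc, ← Real.exp_add, ← Real.exp_add]
        ring_nf

/-- Weighted AM–GM, applied to `∫ exp u dq ≥ δ ∫ exp u dp + (1 - δ) exp (inf u)`. -/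
lemma log_integral_exp_sub_le {p q : Measure Y} [IsProbabilityMeasure p]
    [IsProbabilityMeasure q] {δ : NNReal} (hδ : δ ≤ 1) (hpq : δ • p ≤ q) (u : Y →ᵇ ℝ) :
    Real.log (∫ y, Real.exp (u y) ∂p) - Real.log (∫ y, Real.exp (u y) ∂q) ≤
      (1 - δ) * osc u := by
  have : Nonempty Y := p.nonempty_of_neZero
  have hδ' : (0 : ℝ) ≤ 1 - δ := sub_nonneg.2 (NNReal.coe_le_one.2 hδ)
  set m := ⨅ y, u y
  set E := ∫ y, Real.exp (u y) ∂p
  have hm : ∀ y, m ≤ u y := ciInf_le u.isBounded_range.bddBelow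
  have hE : 0 < E := integral_exp_pos (integrable_exp u p)
  have hlow : δ * E + (1 - δ) * Real.exp m ≤ ∫ y, Real.exp (u y) ∂q := by
    have := integral_mono_measure hpq
      (.of_forall fun y => sub_nonneg.2 (Real.exp_le_exp.2 (hm y)))
      ((integrable_exp u q).sub (integrable_const (Real.exp m)))
    rw [integral_smul_nnreal_measure, integral_sub (integrable_exp u p) (integrable_const _),
      integral_sub (integrable_exp u q) (integrable_const _)] at this
    simp only [integral_const, probReal_univ, NNReal.smul_def, smul_eq_mul] at this
    linarith
  have hlog : δ * Real.log E + (1 - δ) * m ≤ Real.log (∫ y, Real.exp (u y) ∂q) := by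
    have hpos := convex_Ioi (0 : ℝ) hE (Real.exp_pos m) δ.2 hδ' (add_sub_cancel _ _)
    have := strictConcaveOn_log_Ioi.concaveOn.2 hE (Real.exp_pos m) δ.2 hδ' (add_sub_cancel _ _)
    simp only [NNReal.val_eq_coe, smul_eq_mul, Real.log_exp] at hpos this
    exact this.trans (Real.log_le_log hpos hlow)
  have hosc : Real.log E - m ≤ osc u := by
    rw [sub_le_iff_le_add', Real.log_le_iff_le_exp hE]
    have := integral_mono (integrable_exp u p) (integrable_const (Real.exp (m + osc u)))
      fun y => Real.exp_le_exp.2 <| sub_le_iff_le_add.1 <|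
        le_ciInf fun y' => sub_le_comm.1 (sub_le_osc u y y')
    simpa using this
  linarith [mul_le_mul_of_nonneg_left hosc hδ']

end ExponentialTilting

section Schrodinger

variable {X Y : Type*} [TopologicalSpace X] [TopologicalSpace Y]

/-- The density `exp (φ x + ψ y + a (x, y))` with potentials `(φ, ψ)` and log-kernel `a`. -/
noncomputable def gibbsDensity (a : X × Y →ᵇ ℝ) (p : (X →ᵇ ℝ) × (Y →ᵇ ℝ)) : X × Y →ᵇ ℝ :=
  NormedSpace.exp (directSum p + a)

@[simp]
lemma gibbsDensity_apply (a : X × Y →ᵇ ℝ) (p : (X →ᵇ ℝ) × (Y →ᵇ ℝ)) (z : X × Y) :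
    gibbsDensity a p z = Real.exp (p.1 z.1 + p.2 z.2 + a z) :=
  exp_apply _ z

lemma swap_gibbsDensity (a : X × Y →ᵇ ℝ) (p : (X →ᵇ ℝ) × (Y →ᵇ ℝ)) :
    swap (gibbsDensity a p) = gibbsDensity (swap a) p.swap :=
  ext fun z => by simp [add_comm (p.1 z.2)]

section SoftTransform

variable [FirstCountableTopology X] [MeasurableSpace Y] [OpensMeasurableSpace Y]
  (ν : Measure Y) [IsProbabilityMeasure ν]

/-- The soft-min transform `x ↦ -log ∫ exp (ψ y + a (x, y)) dν(y)`. -/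
noncomputable def softTransform (a : X × Y →ᵇ ℝ) (ψ : Y →ᵇ ℝ) : X →ᵇ ℝ :=
  ofNormedAddCommGroup (fun x => -Real.log (∫ y, Real.exp ((ψ + slice a x) y) ∂ν))
    (by
      have hpos := fun x => integral_exp_pos (integrable_exp (ψ + slice a x) ν)
      have hcont : Continuous fun x => ∫ y, Real.exp ((ψ + slice a x) y) ∂ν :=
        (integrateSnd ν (gibbsDensity a (0, ψ))).continuous.congr fun x => by simp
      exact (hcont.log fun x => (hpos x).ne').neg)
    (‖ψ‖ + ‖a‖) fun x => by
      rw [norm_neg]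
      exact (abs_log_integral_exp_le ν _).trans <|
        (norm_add_le _ _).trans (by gcongr; exact norm_slice_le a x)

lemma softTransform_apply (a : X × Y →ᵇ ℝ) (ψ : Y →ᵇ ℝ) (x : X) :
    softTransform ν a ψ x = -Real.log (∫ y, Real.exp ((ψ + slice a x) y) ∂ν) := rfl

lemma integrateSnd_gibbsDensity_softTransform (a : X × Y →ᵇ ℝ) (ψ : Y →ᵇ ℝ) :
    integrateSnd ν (gibbsDensity a (softTransform ν a ψ, ψ)) = 1 := by
  ext x
  have hpos := integral_exp_pos (integrable_exp (ψ + slice a x) ν)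
  simp only [coe_add, Pi.add_apply, slice_apply] at hpos
  simp only [integrateSnd_apply, gibbsDensity_apply, softTransform_apply, add_assoc,
    Real.exp_add (-_), Real.exp_neg, coe_add, Pi.add_apply, slice_apply, Real.exp_log hpos,
    integral_const_mul, inv_mul_cancel₀ hpos.ne', coe_one, Pi.one_apply]

lemma softTransform_sub_apply (a : X × Y →ᵇ ℝ) (ψ₁ ψ₂ : Y →ᵇ ℝ) (x : X) :
    (softTransform ν a ψ₁ - softTransform ν a ψ₂) x =
      -Real.log (∫ y, Real.exp ((ψ₁ - ψ₂) y) ∂ν.tilted ⇑(ψ₂ + slice a x)) := by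
  have h : ⇑(ψ₂ + slice a x) + ⇑(ψ₁ - ψ₂) = ⇑(ψ₁ + slice a x) :=
    funext fun y => by simp only [coe_add, coe_sub, Pi.add_apply, Pi.sub_apply]; ring
  rw [integral_exp_tilted, h, Real.log_div (integral_exp_pos (integrable_exp _ ν)).ne'
    (integral_exp_pos (integrable_exp _ ν)).ne']
  exact neg_sub_neg _ _ |>.trans (neg_sub _ _).symm

/-- The tilted measures `exp (ψ₂ + a (x, ·)) ν` at two points `x` dominate each other up to the
factor `exp (-4 ‖a‖)`: this is Dobrushin's condition. -/
lemma osc_softTransform_sub_le (a : X × Y →ᵇ ℝ) (ψ₁ ψ₂ : Y →ᵇ ℝ) :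
    osc (softTransform ν a ψ₁ - softTransform ν a ψ₂) ≤
      (1 - Real.exp (-(4 * ‖a‖))) * osc (ψ₁ - ψ₂) := by
  have hexp : Real.exp (-(4 * ‖a‖)) ≤ 1 := Real.exp_le_one_iff.2 (by simp)
  refine osc_le (mul_nonneg (sub_nonneg.2 hexp) (osc_nonneg _)) fun x x' => ?_
  have := isProbabilityMeasure_tilted (integrable_exp (ψ₂ + slice a x) ν)
  have := isProbabilityMeasure_tilted (integrable_exp (ψ₂ + slice a x') ν)
  have hdist : ‖(ψ₂ + slice a x') - (ψ₂ + slice a x)‖ ≤ 2 * ‖a‖ := by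
    rw [add_sub_add_left_eq_sub]
    linarith [norm_sub_le (slice a x') (slice a x), norm_slice_le a x, norm_slice_le a x']
  have hle := smul_tilted_le_tilted ν hdist
  rw [← mul_assoc, show (2 * 2 : ℝ) = 4 by norm_num] at hle
  have := log_integral_exp_sub_le (Real.toNNReal_le_one.2 hexp) hle (ψ₁ - ψ₂)
  rw [Real.coe_toNNReal _ (Real.exp_pos _).le] at this
  simpa only [softTransform_sub_apply, neg_sub_neg] using this

end SoftTransform

variable [SecondCountableTopology X] [SecondCountableTopology Y] [MeasurableSpace X]
  [MeasurableSpace Y] [OpensMeasurableSpace X] [OpensMeasurableSpace Y]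
  (μ : Measure X) (ν : Measure Y) [IsProbabilityMeasure μ] [IsProbabilityMeasure ν]

lemma mean_prod_eq_mean_integrateSnd (h : X × Y →ᵇ ℝ) :
    mean (μ.prod ν) h = mean μ (integrateSnd ν h) :=
  integral_prod h (h.integrable _)

lemma mean_prod_eq_mean_integrateFst (h : X × Y →ᵇ ℝ) :
    mean (μ.prod ν) h = mean ν (integrateFst μ h) :=
  integral_prod_symm h (h.integrable _)

variable {μ ν}

lemma eq_one_of_integrateSnd_eq_const {h : X × Y →ᵇ ℝ} {c : ℝ} (hfst : integrateFst μ h = 1)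
    (hsnd : integrateSnd ν h = const X c) : c = 1 := by
  have := (mean_prod_eq_mean_integrateSnd μ ν h).symm.trans (mean_prod_eq_mean_integrateFst μ ν h)
  simpa [hfst, hsnd] using this

variable (μ ν) in
/-- The pair `p = (φ, ψ)` solves the Schrödinger system with log-kernel `a`: the measure with
density `gibbsDensity a p` with respect to `μ ⊗ ν` has marginals `μ` and `ν`. -/
structure IsSchrodingerPair (a : X × Y →ᵇ ℝ) (p : (X →ᵇ ℝ) × (Y →ᵇ ℝ)) : Prop where
  integrateSnd_eq_one : integrateSnd ν (gibbsDensity a p) = 1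
  integrateFst_eq_one : integrateFst μ (gibbsDensity a p) = 1

variable (μ ν) in
/-- Solutions are the fixed points, modulo constants, of the Sinkhorn iteration. -/
theorem exists_isSchrodingerPair (a : X × Y →ᵇ ℝ) : ∃ p, IsSchrodingerPair μ ν a p := by
  have : Nonempty X := μ.nonempty_of_neZero
  let T : (X →ᵇ ℝ) → (X →ᵇ ℝ) := fun φ => softTransform ν a (softTransform μ (swap a) φ)
  have hexp₀ : 0 < Real.exp (-(4 * ‖a‖)) := Real.exp_pos _
  have hexp₁ : Real.exp (-(4 * ‖a‖)) ≤ 1 := Real.exp_le_one_iff.2 (by simp)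
  have hT : ∀ φ₁ φ₂, osc (T φ₁ - T φ₂) ≤ (1 - Real.exp (-(4 * ‖a‖))) * osc (φ₁ - φ₂) := by
    intro φ₁ φ₂
    have hswap := osc_softTransform_sub_le μ (swap a) φ₁ φ₂
    rw [norm_swap] at hswap
    refine (osc_softTransform_sub_le ν a _ _).trans
      (mul_le_mul_of_nonneg_left (hswap.trans ?_) (by linarith))
    exact mul_le_of_le_one_left (osc_nonneg _) (by linarith)
  obtain ⟨φ, κ, hφ⟩ := exists_eq_add_const_of_osc_le (by linarith) (by linarith) hT
  set ψ := softTransform μ (swap a) φ with hψ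
  have hfst : integrateFst μ (gibbsDensity a (φ, ψ)) = 1 := by
    rw [integrateFst, ContinuousLinearMap.comp_apply, swap_gibbsDensity, Prod.swap_prod_mk, hψ,
      integrateSnd_gibbsDensity_softTransform]
  have hdensity : gibbsDensity a (φ, ψ) = Real.exp (-κ) • gibbsDensity a (T φ, ψ) := by
    ext z
    simp only [hφ, gibbsDensity_apply, coe_smul, smul_eq_mul, ← Real.exp_add, coe_add,
      Pi.add_apply, const_apply]
    ring_nf
  have hsnd : integrateSnd ν (gibbsDensity a (φ, ψ)) = const X (Real.exp (-κ)) := by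
    rw [hdensity, map_smul, integrateSnd_gibbsDensity_softTransform]
    ext x
    simp
  refine ⟨(φ, ψ), ?_, hfst⟩
  rw [hsnd, eq_one_of_integrateSnd_eq_const hfst hsnd]
  rfl

end Schrodinger

section RelativeEntropy

variable {Z : Type*} [MeasurableSpace Z] {P π : Measure Z} [IsProbabilityMeasure P] {u : Z → ℝ}

/-- The Donsker–Varadhan inequality. -/
lemma integral_sub_log_le_toReal_klDiv [IsProbabilityMeasure π]
    (hu : Integrable u π) (hexp : Integrable (fun z => Real.exp (u z)) P)
    (hπ : klDiv π P ≠ ⊤) :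
    ∫ z, u z ∂π - Real.log (∫ z, Real.exp (u z) ∂P) ≤ (klDiv π P).toReal := by
  obtain ⟨hac, hint⟩ := klDiv_ne_top_iff.1 hπ
  have := isProbabilityMeasure_tilted hexp
  have hllr := integral_llr_tilted_right hac hu hexp hint
  have hnonneg := integral_llr_add_sub_measure_univ_nonneg
    (hac.trans (absolutelyContinuous_tilted hexp))
    (integrable_llr_tilted_right hac hu hint hexp)
  rw [toReal_klDiv_of_measure_eq hac (by simp)]
  simp only [probReal_univ] at hnonneg
  linarith

lemma llr_tilted_left_self (hexp : Integrable (fun z => Real.exp (u z)) P) :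
    llr (P.tilted u) P =ᵐ[P.tilted u] fun z => u z - Real.log (∫ z, Real.exp (u z) ∂P) :=
  (tilted_absolutelyContinuous P u).ae_le (log_rnDeriv_tilted_left_self hexp)

lemma klDiv_tilted_ne_top (hu : Integrable u (P.tilted u))
    (hexp : Integrable (fun z => Real.exp (u z)) P) : klDiv (P.tilted u) P ≠ ⊤ := by
  have := isProbabilityMeasure_tilted hexp
  exact klDiv_ne_top (tilted_absolutelyContinuous P u)
    ((integrable_congr (llr_tilted_left_self hexp)).2 (hu.sub (integrable_const _)))

lemma toReal_klDiv_tilted (hu : Integrable u (P.tilted u))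
    (hexp : Integrable (fun z => Real.exp (u z)) P) :
    (klDiv (P.tilted u) P).toReal =
      ∫ z, u z ∂(P.tilted u) - Real.log (∫ z, Real.exp (u z) ∂P) := by
  have := isProbabilityMeasure_tilted hexp
  rw [toReal_klDiv_of_measure_eq (tilted_absolutelyContinuous P u) (by simp),
    integral_congr_ae (llr_tilted_left_self hexp), integral_sub hu (integrable_const _)]
  simp

end RelativeEntropy

section Couplings

variable {X Y : Type*} [MeasurableSpace X] [MeasurableSpace Y] {μ : Measure X} {ν : Measure Y}
  {π : Measure (X × Y)}

lemma isProbabilityMeasure_of_mem_couplings [IsProbabilityMeasure μ] (hπ : π ∈ couplings μ ν) :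
    IsProbabilityMeasure π :=
  ⟨by rw [← Measure.fst_univ, hπ.1, measure_univ]⟩

lemma integral_fst_of_mem_couplings (hπ : π ∈ couplings μ ν) {f : X → ℝ}
    (hf : AEStronglyMeasurable f μ) : ∫ z, f z.1 ∂π = ∫ x, f x ∂μ := by
  obtain ⟨rfl, -⟩ := hπ
  exact (integral_map measurable_fst.aemeasurable hf).symm

lemma integral_snd_of_mem_couplings (hπ : π ∈ couplings μ ν) {f : Y → ℝ}
    (hf : AEStronglyMeasurable f ν) : ∫ z, f z.2 ∂π = ∫ y, f y ∂ν := by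
  obtain ⟨-, rfl⟩ := hπ
  exact (integral_map measurable_snd.aemeasurable hf).symm

lemma fst_withDensity_prod [SFinite μ] [SFinite ν] {ρ : X × Y → ENNReal} (hρ : Measurable ρ)
    (h : ∀ x, ∫⁻ y, ρ (x, y) ∂ν = 1) : ((μ.prod ν).withDensity ρ).fst = μ := by
  ext s hs
  rw [Measure.fst_apply hs, withDensity_apply _ (measurable_fst hs), ← prod_univ,
    setLIntegral_prod _ hρ.aemeasurable]
  simp [h]

lemma snd_withDensity_prod [SFinite μ] [SFinite ν] {ρ : X × Y → ENNReal} (hρ : Measurable ρ)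
    (h : ∀ y, ∫⁻ x, ρ (x, y) ∂μ = 1) : ((μ.prod ν).withDensity ρ).snd = ν := by
  ext s hs
  rw [Measure.snd_apply hs, withDensity_apply _ (measurable_snd hs), ← univ_prod,
    setLIntegral_prod_symm _ hρ.aemeasurable]
  simp [h]

variable [TopologicalSpace X] [TopologicalSpace Y] [SecondCountableTopology X]
  [OpensMeasurableSpace X] [OpensMeasurableSpace Y]

lemma mean_directSum_of_mem_couplings [IsProbabilityMeasure μ] [IsProbabilityMeasure ν]
    [IsProbabilityMeasure π] (hπ : π ∈ couplings μ ν) (p : (X →ᵇ ℝ) × (Y →ᵇ ℝ)) :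
    mean π (directSum p) = mean μ p.1 + mean ν p.2 := by
  simp only [mean_apply, directSum_apply]
  rw [integral_add ((directSum (p.1, 0)).integrable π |>.congr ?_)
    ((directSum (0, p.2)).integrable π |>.congr ?_),
    integral_fst_of_mem_couplings hπ p.1.continuous.aestronglyMeasurable,
    integral_snd_of_mem_couplings hπ p.2.continuous.aestronglyMeasurable] <;>
  exact .of_forall fun z => by simp

end Couplings

section Duality

variable {X Y : Type*} [TopologicalSpace X] [TopologicalSpace Y]
  [SecondCountableTopology X] [SecondCountableTopology Y]
  [MeasurableSpace X] [MeasurableSpace Y] [OpensMeasurableSpace X] [OpensMeasurableSpace Y]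
  {μ : Measure X} {ν : Measure Y} [IsProbabilityMeasure μ] [IsProbabilityMeasure ν]
  {a : X × Y →ᵇ ℝ} {p : (X →ᵇ ℝ) × (Y →ᵇ ℝ)}

variable (μ ν) in
/-- The measure `exp (φ ⊕ ψ + a) μ ⊗ ν`, normalised to be a probability measure. -/
noncomputable def gibbsPlan (a : X × Y →ᵇ ℝ) (p : (X →ᵇ ℝ) × (Y →ᵇ ℝ)) : Measure (X × Y) :=
  (μ.prod ν).tilted ⇑(directSum p + a)

instance isProbabilityMeasure_gibbsPlan : IsProbabilityMeasure (gibbsPlan μ ν a p) :=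
  isProbabilityMeasure_tilted (integrable_exp _ _)

namespace IsSchrodingerPair

lemma mean_gibbsDensity (h : IsSchrodingerPair μ ν a p) :
    mean (μ.prod ν) (gibbsDensity a p) = 1 := by
  rw [mean_prod_eq_mean_integrateSnd, h.integrateSnd_eq_one]
  simp

lemma integral_exp (h : IsSchrodingerPair μ ν a p) :
    ∫ z, Real.exp ((directSum p + a) z) ∂(μ.prod ν) = 1 := by
  simpa using h.mean_gibbsDensity

lemma gibbsPlan_eq_withDensity (h : IsSchrodingerPair μ ν a p) :
    gibbsPlan μ ν a p = (μ.prod ν).withDensity fun z => ENNReal.ofReal (gibbsDensity a p z) := by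
  simp only [gibbsPlan, Measure.tilted, h.integral_exp, div_one]
  simp

lemma gibbsPlan_mem_couplings (h : IsSchrodingerPair μ ν a p) :
    gibbsPlan μ ν a p ∈ couplings μ ν := by
  have hmeas : Measurable fun z => ENNReal.ofReal (gibbsDensity a p z) :=
    (gibbsDensity a p).continuous.measurable.ennreal_ofReal
  have hnonneg : ∀ z, 0 ≤ gibbsDensity a p z := fun z => by
    simpa using (Real.exp_pos _).le
  rw [h.gibbsPlan_eq_withDensity]
  refine ⟨fst_withDensity_prod hmeas fun x => ?_, snd_withDensity_prod hmeas fun y => ?_⟩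
  · have := DFunLike.congr_fun h.integrateSnd_eq_one x
    rw [integrateSnd_apply] at this
    refine (ofReal_integral_eq_lintegral_ofReal ((slice (gibbsDensity a p) x).integrable ν)
      (.of_forall fun y => hnonneg _)).symm.trans ?_
    simp only [slice_apply, this, coe_one, Pi.one_apply, ENNReal.ofReal_one]
  · have := DFunLike.congr_fun h.integrateFst_eq_one y
    rw [integrateFst_apply] at this
    refine (ofReal_integral_eq_lintegral_ofReal
      ((slice (swap (gibbsDensity a p)) y).integrable μ) (.of_forall fun x => hnonneg _)).symm.trans
      ?_
    simp only [slice_apply, swap_apply, Prod.swap_prod_mk, this, coe_one, Pi.one_apply,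
      ENNReal.ofReal_one]

lemma integral_exp_gibbsPlan (h : IsSchrodingerPair μ ν a p) (w : X × Y →ᵇ ℝ) :
    ∫ z, Real.exp (w z) ∂(gibbsPlan μ ν a p) =
      ∫ z, Real.exp ((directSum p + a + w) z) ∂(μ.prod ν) := by
  rw [gibbsPlan, integral_exp_tilted, h.integral_exp, div_one]
  rfl

end IsSchrodingerPair

variable (μ ν) in
/-- The objective of the dual problem with log-kernel `a`, in its unconstrained form with the
total mass as a penalty. -/
noncomputable def dualObjective (a : X × Y →ᵇ ℝ) (p : (X →ᵇ ℝ) × (Y →ᵇ ℝ)) : ℝ :=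
  mean μ p.1 + mean ν p.2 + 1 - mean (μ.prod ν) (gibbsDensity a p)

variable (μ ν) in
/-- The value of the dual problem with log-kernel `a`. -/
noncomputable def dualValue (a : X × Y →ᵇ ℝ) : ℝ := ⨆ p, dualObjective μ ν a p

namespace IsSchrodingerPair

lemma dualObjective_self (h : IsSchrodingerPair μ ν a p) :
    dualObjective μ ν a p = mean μ p.1 + mean ν p.2 := by
  rw [dualObjective, h.mean_gibbsDensity, add_sub_cancel_right]

/-- Relative to the plan at `a`, the mass of the density at `(a', p')` is the mean of `exp w` with
`w = p' - p + a' - a`, and `exp w ≥ w + 1`. -/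
lemma dualObjective_le (h : IsSchrodingerPair μ ν a p) (a' : X × Y →ᵇ ℝ)
    (p' : (X →ᵇ ℝ) × (Y →ᵇ ℝ)) :
    dualObjective μ ν a' p' ≤
      mean μ p.1 + mean ν p.2 - mean (gibbsPlan μ ν a p) (a' - a) := by
  set π := gibbsPlan μ ν a p
  set w := directSum (p' - p) + (a' - a) with hw
  have hmass : mean (μ.prod ν) (gibbsDensity a' p') = ∫ z, Real.exp (w z) ∂π := by
    rw [h.integral_exp_gibbsPlan, hw, map_sub, mean_apply]
    simp only [gibbsDensity_apply]
    congr! 3 with z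
    simp only [coe_add, coe_sub, Pi.add_apply, Pi.sub_apply, directSum_apply]
    ring
  have htangent : mean π w + 1 ≤ ∫ z, Real.exp (w z) ∂π := by
    have := integral_mono ((w.integrable π).add (integrable_const 1)) (integrable_exp w π)
      fun z => Real.add_one_le_exp (w z)
    rwa [integral_add' (w.integrable π) (integrable_const 1), integral_const, probReal_univ,
      one_smul] at this
  have hmean : mean π w = mean μ p'.1 + mean ν p'.2 - (mean μ p.1 + mean ν p.2) +
      mean π (a' - a) := by
    rw [hw, map_add, map_sub directSum, map_sub (mean π),
      mean_directSum_of_mem_couplings h.gibbsPlan_mem_couplings,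
      mean_directSum_of_mem_couplings h.gibbsPlan_mem_couplings]
  rw [dualObjective, hmass]
  linarith

lemma dualValue_eq (h : IsSchrodingerPair μ ν a p) :
    dualValue μ ν a = mean μ p.1 + mean ν p.2 := by
  have hle : ∀ p', dualObjective μ ν a p' ≤ mean μ p.1 + mean ν p.2 := fun p' => by
    simpa using h.dualObjective_le a p'
  exact le_antisymm (ciSup_le hle)
    (h.dualObjective_self.ge.trans (le_ciSup ⟨_, forall_mem_range.2 hle⟩ p))

lemma dualValue_add_le (h : IsSchrodingerPair μ ν a p) (w : X × Y →ᵇ ℝ) :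
    dualValue μ ν (a + w) ≤ dualValue μ ν a - mean (gibbsPlan μ ν a p) w := by
  refine ciSup_le fun p' => ?_
  simpa only [h.dualValue_eq, add_sub_cancel_left] using h.dualObjective_le (a + w) p'

lemma le_dualValue_add (h : IsSchrodingerPair μ ν a p) (w : X × Y →ᵇ ℝ) :
    dualValue μ ν a + 1 - ∫ z, Real.exp (w z) ∂(gibbsPlan μ ν a p) ≤ dualValue μ ν (a + w) := by
  obtain ⟨q, hq⟩ := exists_isSchrodingerPair μ ν (a + w)
  have hbdd : BddAbove (range (dualObjective μ ν (a + w))) :=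
    ⟨_, forall_mem_range.2 (hq.dualObjective_le (a + w))⟩
  have hmass : mean (μ.prod ν) (gibbsDensity (a + w) p) =
      ∫ z, Real.exp (w z) ∂(gibbsPlan μ ν a p) := by
    rw [h.integral_exp_gibbsPlan, add_assoc, mean_apply]
    exact integral_congr_ae (.of_forall fun z => gibbsDensity_apply _ _ z)
  rw [h.dualValue_eq, ← hmass]
  exact le_ciSup hbdd p

lemma mean_directSum_add (h : IsSchrodingerPair μ ν a p) {π : Measure (X × Y)}
    [IsProbabilityMeasure π] (hπ : π ∈ couplings μ ν) :
    mean π (directSum p + a) = dualValue μ ν a + mean π a := by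
  rw [map_add, mean_directSum_of_mem_couplings hπ, h.dualValue_eq]

lemma toReal_klDiv_gibbsPlan (h : IsSchrodingerPair μ ν a p) :
    (klDiv (gibbsPlan μ ν a p) (μ.prod ν)).toReal =
      dualValue μ ν a + mean (gibbsPlan μ ν a p) a := by
  have := toReal_klDiv_tilted ((directSum p + a).integrable (gibbsPlan μ ν a p))
    (integrable_exp (directSum p + a) (μ.prod ν))
  rw [h.integral_exp, Real.log_one, sub_zero] at this
  rw [← h.mean_directSum_add h.gibbsPlan_mem_couplings]
  exact this

end IsSchrodingerPair

lemma dualValue_add_mean_le_toReal_klDiv {π : Measure (X × Y)} [IsProbabilityMeasure π]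
    (hπ : π ∈ couplings μ ν) (hkl : klDiv π (μ.prod ν) ≠ ⊤) :
    dualValue μ ν a + mean π a ≤ (klDiv π (μ.prod ν)).toReal := by
  obtain ⟨p, h⟩ := exists_isSchrodingerPair μ ν a
  have := integral_sub_log_le_toReal_klDiv ((directSum p + a).integrable π)
    (integrable_exp _ _) hkl
  rwa [h.integral_exp, Real.log_one, sub_zero, ← mean_apply, h.mean_directSum_add hπ] at this

lemma neg_norm_le_dualValue : -‖a‖ ≤ dualValue μ ν a := by
  obtain ⟨p, h⟩ := exists_isSchrodingerPair μ ν a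
  have hkl := h.toReal_klDiv_gibbsPlan.symm ▸ ENNReal.toReal_nonneg
  linarith [le_of_abs_le (abs_mean_le (gibbsPlan μ ν a p) a)]

theorem entropicOT_eq_dualValue {c : X → Y → ℝ} {ε : ℝ} (hε : 0 < ε)
    (hc : ∀ᵐ z ∂(μ.prod ν), c z.1 z.2 = -ε * a z) :
    entropicOT c ε μ ν = ((ε * dualValue μ ν a : ℝ) : EReal) := by
  have cost_eq : ∀ (π : Measure (X × Y)) [IsProbabilityMeasure π], klDiv π (μ.prod ν) ≠ ⊤ →
      ((∫ z, c z.1 z.2 ∂π : ℝ) : EReal) + (ε : EReal) * (klDiv π (μ.prod ν) : EReal) =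
        ((ε * ((klDiv π (μ.prod ν)).toReal - mean π a) : ℝ) : EReal) := by
    intro π _ hkl
    have hac : π ≪ μ.prod ν := (klDiv_ne_top_iff.1 hkl).1
    rw [integral_congr_ae (hac.ae_le hc), integral_const_mul, ← mean_apply,
      ← EReal.coe_ennreal_toReal hkl, ← EReal.coe_mul, ← EReal.coe_add]
    ring_nf
  refine le_antisymm ?_ (le_iInf₂ fun π hπ => ?_)
  · obtain ⟨p, h⟩ := exists_isSchrodingerPair μ ν a
    have hkl : klDiv (gibbsPlan μ ν a p) (μ.prod ν) ≠ ⊤ :=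
      klDiv_tilted_ne_top ((directSum p + a).integrable _) (integrable_exp _ _)
    refine (iInf₂_le _ h.gibbsPlan_mem_couplings).trans_eq ?_
    rw [cost_eq _ hkl, h.toReal_klDiv_gibbsPlan, add_sub_cancel_right]
  · have := isProbabilityMeasure_of_mem_couplings hπ
    by_cases hkl : klDiv π (μ.prod ν) = ⊤
    · rw [hkl, EReal.coe_ennreal_top, EReal.coe_mul_top_of_pos hε, EReal.coe_add_top]
      exact le_top
    · rw [cost_eq π hkl, EReal.coe_le_coe_iff]
      gcongr
      exact le_sub_iff_add_le.2 (dualValue_add_mean_le_toReal_klDiv hπ hkl)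

end Duality

section Smoothness

lemma bijective_of_bijective_schur {R E F G : Type*} [Ring R] [AddCommGroup E] [AddCommGroup F]
    [AddCommGroup G] [Module R E] [Module R F] [Module R G] {A : E →ₗ[R] G} {K : F →ₗ[R] G}
    {K' : E →ₗ[R] F} (hS : Function.Bijective (A - K ∘ₗ K')) :
    Function.Bijective fun p : E × F => (A p.1 + K p.2, K' p.1 + p.2) := by
  have elim : ∀ p : E × F, (A - K ∘ₗ K') p.1 = A p.1 + K p.2 - K (K' p.1 + p.2) := fun p => by
    simp
  refine ⟨fun p q h => ?_, fun r => ?_⟩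
  · obtain ⟨h₁, h₂⟩ := Prod.mk.inj h
    have hfst : p.1 = q.1 := hS.injective (by rw [elim, elim, h₁, h₂])
    rw [hfst] at h₂
    exact Prod.ext hfst (add_left_cancel h₂)
  · obtain ⟨f, hf⟩ := hS.surjective (r.1 - K r.2)
    refine ⟨(f, r.2 - K' f), Prod.ext ?_ (add_sub_cancel _ _)⟩
    have := elim (f, r.2 - K' f)
    rw [hf, add_sub_cancel, sub_left_inj] at this
    exact this.symm

variable {X Y : Type*} [TopologicalSpace X] [TopologicalSpace Y]

section DensityOperator

variable [FirstCountableTopology X] [MeasurableSpace Y] [OpensMeasurableSpace Y]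
  (ν : Measure Y) [IsProbabilityMeasure ν]

/-- The integral operator `g ↦ ∫ ρ (·, y) g y dν(y)` with density `ρ`. -/
noncomputable def densityOp (ρ : X × Y →ᵇ ℝ) : (Y →ᵇ ℝ) →L[ℝ] (X →ᵇ ℝ) :=
  (integrateSnd ν).comp ((ContinuousLinearMap.mul ℝ _ ρ).comp (directSum.comp (.inr ℝ _ _)))

@[simp]
lemma densityOp_apply (ρ : X × Y →ᵇ ℝ) (g : Y →ᵇ ℝ) (x : X) :
    densityOp ν ρ g x = ∫ y, ρ (x, y) * g y ∂ν := by
  simp [densityOp]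

lemma densityOp_one (ρ : X × Y →ᵇ ℝ) : densityOp ν ρ 1 = integrateSnd ν ρ :=
  ext fun x => by simp

lemma densityOp_sub_const (ρ : X × Y →ᵇ ℝ) (δ : ℝ) :
    densityOp ν (ρ - const _ δ) = densityOp ν ρ - (δ • mean ν).smulRight 1 := by
  ext g x
  have hρg : Integrable (fun y => ρ (x, y) * g y) ν := (slice ρ x * g).integrable ν
  simp [sub_mul, integral_sub hρg ((g.integrable ν).const_mul δ), integral_const_mul]

lemma norm_densityOp_le {ρ : X × Y →ᵇ ℝ} (hρ : ∀ z, 0 ≤ ρ z) :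
    ‖densityOp ν ρ‖ ≤ ‖integrateSnd ν ρ‖ := by
  refine ContinuousLinearMap.opNorm_le_bound _ (norm_nonneg _) fun g =>
    (norm_le (by positivity)).2 fun x => ?_
  calc ‖densityOp ν ρ g x‖ ≤ ∫ y, ρ (x, y) * ‖g‖ ∂ν := by
        rw [densityOp_apply]
        refine norm_integral_le_of_norm_le (((slice ρ x).integrable ν).mul_const _)
          (.of_forall fun y => ?_)
        rw [norm_mul, Real.norm_of_nonneg (hρ _)]
        exact mul_le_mul_of_nonneg_left (g.norm_coe_le_norm y) (hρ _)
    _ = integrateSnd ν ρ x * ‖g‖ := integral_mul_const _ _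
    _ ≤ ‖integrateSnd ν ρ‖ * ‖g‖ := by gcongr; exact apply_le_norm _ x

lemma integrateSnd_mul_directSum (ρ : X × Y →ᵇ ℝ) (p : (X →ᵇ ℝ) × (Y →ᵇ ℝ)) :
    integrateSnd ν (ρ * directSum p) = integrateSnd ν ρ * p.1 + densityOp ν ρ p.2 := by
  ext x
  have hfst : Integrable (fun y => ρ (x, y) * p.1 x) ν := ((slice ρ x).integrable ν).mul_const _
  have hsnd : Integrable (fun y => ρ (x, y) * p.2 y) ν := (slice ρ x * p.2).integrable ν
  simp [mul_add, integral_add hfst hsnd, integral_mul_const]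

lemma integrateFst_mul_directSum (ρ : Y × X →ᵇ ℝ) (p : (Y →ᵇ ℝ) × (X →ᵇ ℝ)) :
    integrateFst ν (ρ * directSum p) =
      densityOp ν (swap ρ) p.1 + integrateFst ν ρ * p.2 := by
  have hswap : swap (ρ * directSum p) = swap ρ * directSum p.swap :=
    ext fun z => by simp [add_comm (p.1 z.2)]
  rw [integrateFst, ContinuousLinearMap.comp_apply, hswap, integrateSnd_mul_directSum, add_comm]
  rfl

end DensityOperator

variable [SecondCountableTopology X] [SecondCountableTopology Y] [MeasurableSpace X]
  [MeasurableSpace Y] [OpensMeasurableSpace X] [OpensMeasurableSpace Y]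
  (μ : Measure X) (ν : Measure Y) [IsProbabilityMeasure μ] [IsProbabilityMeasure ν]

/-- The Schrödinger system as a map of the log-kernel and the potentials. The summand
`δ ∫ φ dμ` removes the degeneracy `(φ, ψ) ↦ (φ + c, ψ - c)`. -/
noncomputable def schrodingerMap (δ : ℝ) (z : (X × Y →ᵇ ℝ) × ((X →ᵇ ℝ) × (Y →ᵇ ℝ))) :
    (X →ᵇ ℝ) × (Y →ᵇ ℝ) :=
  (integrateSnd ν (gibbsDensity z.1 z.2) + (δ • mean μ).smulRight 1 z.2.1,
    integrateFst μ (gibbsDensity z.1 z.2))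

/-- The derivative of the Schrödinger system in the potentials, at a solution with density `ρ`. -/
noncomputable def linearizedMap (δ : ℝ) (ρ : X × Y →ᵇ ℝ) :
    (X →ᵇ ℝ) × (Y →ᵇ ℝ) →L[ℝ] (X →ᵇ ℝ) × (Y →ᵇ ℝ) :=
  ((1 + (δ • mean μ).smulRight 1 : (X →ᵇ ℝ) →L[ℝ] (X →ᵇ ℝ)).coprod (densityOp ν ρ)).prod
    ((densityOp μ (swap ρ)).coprod 1)

lemma contDiff_schrodingerMap (δ : ℝ) {n : WithTop ℕ∞} :
    ContDiff ℝ n (schrodingerMap μ ν δ) := by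
  have hexp : ContDiff ℝ n (NormedSpace.exp : (X × Y →ᵇ ℝ) → (X × Y →ᵇ ℝ)) :=
    contDiff_iff_contDiffAt.2 fun f => (NormedSpace.exp_analytic f).contDiffAt
  have hdensity : ContDiff ℝ n fun z : (X × Y →ᵇ ℝ) × ((X →ᵇ ℝ) × (Y →ᵇ ℝ)) =>
      gibbsDensity z.1 z.2 := hexp.comp (by fun_prop)
  unfold schrodingerMap
  fun_prop

variable {μ ν}

lemma IsSchrodingerPair.hasFDerivAt_schrodingerMap {a : X × Y →ᵇ ℝ}
    {p : (X →ᵇ ℝ) × (Y →ᵇ ℝ)} (h : IsSchrodingerPair μ ν a p) (δ : ℝ) :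
    HasFDerivAt (fun q => schrodingerMap μ ν δ (a, q))
      (linearizedMap μ ν δ (gibbsDensity a p)) p := by
  have hdensity : HasFDerivAt (gibbsDensity a)
      ((ContinuousLinearMap.mul ℝ _ (gibbsDensity a p)).comp directSum) p :=
    (hasFDerivAt_exp (𝕂 := ℝ) (x := directSum p + a)).comp p (directSum.hasFDerivAt.add_const a)
  have hgauge := ((δ • mean μ).smulRight (1 : X →ᵇ ℝ)).hasFDerivAt.comp p
    (hasFDerivAt_fst (𝕜 := ℝ) (p := p))
  have hmap := (((integrateSnd ν).hasFDerivAt.comp p hdensity).add hgauge).prodMk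
    ((integrateFst μ).hasFDerivAt.comp p hdensity)
  refine hmap.congr_fderiv (ContinuousLinearMap.ext fun q => ?_)
  refine Prod.ext ?_ ?_
  · simp only [ContinuousLinearMap.prod_apply, _root_.add_apply,
      ContinuousLinearMap.comp_apply, ContinuousLinearMap.mul_apply', integrateSnd_mul_directSum,
      h.integrateSnd_eq_one, one_mul, linearizedMap, ContinuousLinearMap.coprod_apply,
      one_apply_eq_self]
    abel
  · simp only [ContinuousLinearMap.prod_apply, _root_.add_apply,
      ContinuousLinearMap.comp_apply, ContinuousLinearMap.mul_apply', integrateFst_mul_directSum,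
      h.integrateFst_eq_one, one_mul, linearizedMap, ContinuousLinearMap.coprod_apply,
      one_apply_eq_self]

/-- Since `densityOp ν ρ` fixes the constants, the Schur complement is `1 - densityOp ν ρ ∘ R`
where `R` has the density `ρ - δ ≥ 0`, of mass `1 - δ`. -/
lemma bijective_linearizedMap {ρ : X × Y →ᵇ ℝ} {δ : ℝ} (hδ₀ : 0 < δ) (hδ₁ : δ ≤ 1)
    (hρ : ∀ z, δ ≤ ρ z) (hsnd : integrateSnd ν ρ = 1) (hfst : integrateFst μ ρ = 1) :
    Function.Bijective (linearizedMap μ ν δ ρ) := by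
  set R := densityOp μ (swap ρ - const _ δ)
  have hschur : 1 + (δ • mean μ).smulRight 1 - (densityOp ν ρ).comp (densityOp μ (swap ρ)) =
      1 - (densityOp ν ρ).comp R := by
    ext f : 1
    simp [R, densityOp_sub_const, densityOp_one, hsnd, sub_sub_eq_add_sub, add_sub_right_comm]
  have hK : ‖densityOp ν ρ‖ ≤ 1 := by
    refine (norm_densityOp_le ν fun z => hδ₀.le.trans (hρ z)).trans ?_
    rw [hsnd]
    exact (norm_const_le (1 : ℝ)).trans_eq norm_one
  have hR : ‖R‖ ≤ 1 - δ := by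
    refine (norm_densityOp_le μ fun z => sub_nonneg.2 (hρ z.swap)).trans ?_
    have hmass : integrateSnd μ (swap ρ - const _ δ) = const Y (1 - δ) := by
      rw [map_sub, show integrateSnd μ (swap ρ) = 1 from hfst]
      ext y
      simp
    rw [hmass]
    exact (norm_const_le _).trans_eq (Real.norm_of_nonneg (sub_nonneg.2 hδ₁))
  have hnorm : ‖(densityOp ν ρ).comp R‖ < 1 :=
    calc ‖(densityOp ν ρ).comp R‖ ≤ ‖densityOp ν ρ‖ * ‖R‖ := ContinuousLinearMap.opNorm_comp_le _ _
      _ ≤ 1 * (1 - δ) := by gcongr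
      _ < 1 := by linarith
  have hunit := isUnit_one_sub_of_norm_lt_one (R := (X →ᵇ ℝ) →L[ℝ] (X →ᵇ ℝ)) hnorm
  rw [← hschur, ContinuousLinearMap.isUnit_iff_bijective] at hunit
  exact bijective_of_bijective_schur (R := ℝ) hunit

lemma IsSchrodingerPair.of_schrodingerMap_eq {δ : ℝ} {a₀ a : X × Y →ᵇ ℝ}
    {p₀ p : (X →ᵇ ℝ) × (Y →ᵇ ℝ)} (h₀ : IsSchrodingerPair μ ν a₀ p₀)
    (h : schrodingerMap μ ν δ (a, p) = schrodingerMap μ ν δ (a₀, p₀)) :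
    IsSchrodingerPair μ ν a p := by
  obtain ⟨hsnd, hfst⟩ := Prod.mk.inj h
  simp only [h₀.integrateFst_eq_one, h₀.integrateSnd_eq_one] at hfst hsnd
  have hconst : integrateSnd ν (gibbsDensity a p) =
      const X (1 + δ * mean μ p₀.1 - δ * mean μ p.1) := by
    rw [eq_sub_of_add_eq hsnd]
    ext x
    simp
  refine ⟨?_, hfst⟩
  rw [hconst, eq_one_of_integrateSnd_eq_const hfst hconst]
  rfl

variable (μ ν) in
theorem contDiff_dualValue {n : WithTop ℕ∞} (hn : n ≠ 0) : ContDiff ℝ n (dualValue μ ν) := by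
  refine contDiff_iff_contDiffAt.2 fun a => ?_
  obtain ⟨p, h⟩ := exists_isSchrodingerPair μ ν a
  set δ := Real.exp (-‖directSum p + a‖)
  have hsmooth : ContDiffAt ℝ n (schrodingerMap μ ν δ) (a, p) :=
    (contDiff_schrodingerMap μ ν δ).contDiffAt
  have hderiv : fderiv ℝ (schrodingerMap μ ν δ) (a, p) ∘L .inr ℝ _ _ = _ :=
    ((hsmooth.differentiableAt hn).hasFDerivAt.comp p
      (hasFDerivAt_prodMk_right a p)).unique (h.hasFDerivAt_schrodingerMap δ)
  have hbij := bijective_linearizedMap (Real.exp_pos _)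
    (Real.exp_le_one_iff.2 (neg_nonpos.2 (norm_nonneg (directSum p + a))))
    (fun z => (Real.exp_le_exp.2 (neg_norm_le_apply _ z)).trans_eq (exp_apply _ z).symm)
    h.integrateSnd_eq_one h.integrateFst_eq_one
  have hinv : (fderiv ℝ (schrodingerMap μ ν δ) (a, p) ∘L .inr ℝ _ _).IsInvertible := by
    rw [hderiv]
    exact ⟨ContinuousLinearEquiv.ofBijective _ (LinearMap.ker_eq_bot.2 hbij.1)
      (LinearMap.range_eq_top.2 hbij.2), ContinuousLinearEquiv.coe_ofBijective _ _ _⟩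
  have hsol := hsmooth.contDiffAt_implicitFunction hn hinv
  have hmean : ContDiffAt ℝ n (fun b => mean μ (hsmooth.implicitFunction hn hinv b).1 +
      mean ν (hsmooth.implicitFunction hn hinv b).2) a := by fun_prop
  refine hmean.congr_of_eventuallyEq ?_
  filter_upwards [hsmooth.eventually_apply_implicitFunction hn hinv] with b hb
  exact (h.of_schrodingerMap_eq hb).dualValue_eq

end Smoothness

section SecondOrder

lemma nonneg_of_isLocalMin_of_hasDerivAt {h h' : ℝ → ℝ} {c t : ℝ} (hmin : IsLocalMin h t)
    (hh : ∀ s, HasDerivAt h (h' s) s) (hh' : HasDerivAt h' c t) : 0 ≤ c := by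
  have hderiv : deriv h = h' := funext fun s => (hh s).deriv
  have hderiv2 : deriv (deriv h) t = c := by rw [hderiv, hh'.deriv]
  by_contra! hc
  have hmax : IsLocalMax h t :=
    isLocalMax_of_deriv_deriv_neg (hderiv2.trans_lt hc) hmin.deriv_eq_zero (hh t).continuousAt
  have hconst : h =ᶠ[𝓝 t] fun _ => h t := by
    filter_upwards [hmin, hmax] with s hle hge using le_antisymm hge hle
  have hzero : deriv (deriv h) t = 0 := by
    rw [hconst.deriv.deriv_eq]
    simp
  exact hc.ne (hderiv2.symm.trans hzero)

variable {E : Type*} [NormedAddCommGroup E] [NormedSpace ℝ E] {f : E → ℝ}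

lemma hasDerivAt_line (x v : E) (t : ℝ) : HasDerivAt (fun s : ℝ => x + s • v) v t := by
  simpa using ((hasDerivAt_id t).smul_const v).const_add x

lemma hasDerivAt_comp_line (hf : ContDiff ℝ 2 f) (x v : E) (t : ℝ) :
    HasDerivAt (fun s : ℝ => f (x + s • v)) (fderiv ℝ f (x + t • v) v) t :=
  (hf.differentiable two_ne_zero _).hasFDerivAt.comp_hasDerivAt t (hasDerivAt_line x v t)

lemma hasDerivAt_fderiv_comp_line (hf : ContDiff ℝ 2 f) (x v : E) (t : ℝ) :
    HasDerivAt (fun s : ℝ => fderiv ℝ f (x + s • v) v)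
      (fderiv ℝ (fderiv ℝ f) (x + t • v) v v) t := by
  have hf' : ContDiff ℝ 1 (fderiv ℝ f) := hf.fderiv_right (by norm_num)
  have := (hf'.differentiable one_ne_zero _).hasFDerivAt.comp_hasDerivAt t (hasDerivAt_line x v t)
  simpa using this.clm_apply (hasDerivAt_const t v)

section Touching

variable {g g' : ℝ → ℝ} {c : ℝ} {x v : E}

lemma second_fderiv_le_of_le_on_line (hf : ContDiff ℝ 2 f) (hle : ∀ t : ℝ, f (x + t • v) ≤ g t)
    (heq : g 0 = f x) (hg : ∀ t, HasDerivAt g (g' t) t) (hg' : HasDerivAt g' c 0) :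
    fderiv ℝ (fderiv ℝ f) x v v ≤ c := by
  have hmin : IsLocalMin (fun t : ℝ => g t - f (x + t • v)) 0 := .of_forall fun t => by
    simpa [heq] using hle t
  have := nonneg_of_isLocalMin_of_hasDerivAt hmin
    (fun t => (hg t).sub (hasDerivAt_comp_line hf x v t))
    (hg'.sub (hasDerivAt_fderiv_comp_line hf x v 0))
  simpa using this

lemma le_second_fderiv_of_le_on_line (hf : ContDiff ℝ 2 f) (hle : ∀ t : ℝ, g t ≤ f (x + t • v))
    (heq : g 0 = f x) (hg : ∀ t, HasDerivAt g (g' t) t) (hg' : HasDerivAt g' c 0) :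
    c ≤ fderiv ℝ (fderiv ℝ f) x v v := by
  have hmin : IsLocalMin (fun t : ℝ => f (x + t • v) - g t) 0 := .of_forall fun t => by
    simpa [heq] using hle t
  have := nonneg_of_isLocalMin_of_hasDerivAt hmin
    (fun t => (hasDerivAt_comp_line hf x v t).sub (hg t))
    ((hasDerivAt_fderiv_comp_line hf x v 0).sub hg')
  simpa using this

end Touching

lemma strongConvexOn_univ_of_le_deriv2 {h h' h'' : ℝ → ℝ} {m : ℝ}
    (hh : ∀ t, HasDerivAt h (h' t) t) (hh' : ∀ t, HasDerivAt h' (h'' t) t) (hm : ∀ t, m ≤ h'' t) :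
    StrongConvexOn univ m h := by
  rw [strongConvexOn_iff_convex]
  have hderiv : ∀ t, HasDerivAt (fun s => h s - m / 2 * ‖s‖ ^ 2) (h' t - m * t) t := fun t => by
    refine ((hh t).fun_sub ((hasDerivAt_id' t).norm_sq.const_mul (m / 2))).congr_deriv ?_
    simp only [RCLike.inner_apply, conj_trivial]
    ring
  have hderiv2 : ∀ t, HasDerivAt (fun s => h' s - m * s) (h'' t - m) t := fun t => by
    simpa using (hh' t).fun_sub ((hasDerivAt_id' t).const_mul m)
  have hfun := funext fun t => (hderiv t).deriv
  refine convexOn_univ_of_deriv2_nonneg (fun t => (hderiv t).differentiableAt) ?_ fun t => ?_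
  · rw [hfun]
    exact fun t => (hderiv2 t).differentiableAt
  · rw [Function.iterate_succ, Function.iterate_one, Function.comp_apply, hfun, (hderiv2 t).deriv]
    exact sub_nonneg.2 (hm t)

lemma strongConvexOn_univ_of_le_second_fderiv (hf : ContDiff ℝ 2 f) {m : ℝ}
    (hm : ∀ x v, m * ‖v‖ ^ 2 ≤ fderiv ℝ (fderiv ℝ f) x v v) : StrongConvexOn univ m f := by
  refine ⟨convex_univ, fun x _ y _ a b ha hb hab => ?_⟩
  have hline : StrongConvexOn univ (m * ‖y - x‖ ^ 2) fun t : ℝ => f (x + t • (y - x)) :=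
    strongConvexOn_univ_of_le_deriv2 (hasDerivAt_comp_line hf x (y - x))
      (hasDerivAt_fderiv_comp_line hf x (y - x)) fun t => hm _ _
  have hpoint : x + b • (y - x) = a • x + b • y := by
    rw [eq_sub_of_add_eq hab]
    module
  have := hline.2 (mem_univ 0) (mem_univ 1) ha hb hab
  simp only [smul_eq_mul, mul_zero, mul_one, zero_add, zero_smul, add_zero, one_smul,
    add_sub_cancel, zero_sub, norm_neg, norm_one, one_pow, hpoint] at this
  refine this.trans_eq ?_
  simp only [smul_eq_mul, norm_sub_rev x y]
  ring

end SecondOrder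

section ExponentialMoments

variable {Z : Type*} [TopologicalSpace Z] [MeasurableSpace Z] [OpensMeasurableSpace Z]
  {π : Measure Z} [IsFiniteMeasure π] {w : Z →ᵇ ℝ} {t : ℝ}

lemma mem_interior_integrableExpSet :
    t ∈ interior (ProbabilityTheory.integrableExpSet w π) := by
  have : ProbabilityTheory.integrableExpSet w π = univ :=
    eq_univ_of_forall fun s => integrable_exp (s • w) π
  simp [this]

lemma hasDerivAt_integral_exp :
    HasDerivAt (fun s : ℝ => ∫ z, Real.exp (s * w z) ∂π)
      (∫ z, w z * Real.exp (t * w z) ∂π) t :=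
  ProbabilityTheory.hasDerivAt_mgf mem_interior_integrableExpSet

lemma hasDerivAt_integral_mul_exp :
    HasDerivAt (fun s : ℝ => ∫ z, w z * Real.exp (s * w z) ∂π)
      (∫ z, w z ^ 2 * Real.exp (t * w z) ∂π) t := by
  simpa using ProbabilityTheory.hasDerivAt_integral_pow_mul_exp_real
    (mem_interior_integrableExpSet (π := π) (w := w)) 1

end ExponentialMoments

section Spectrum

lemma norm_apply_le_of_isSymmetric {𝕜 E : Type*} [RCLike 𝕜] [NormedAddCommGroup E]
    [InnerProductSpace 𝕜 E] [FiniteDimensional 𝕜 E] {T : E →ₗ[𝕜] E} (hT : T.IsSymmetric) {C : ℝ}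
    (hC : 0 ≤ C) (h : ∀ l, Module.End.HasEigenvalue T l → ‖l‖ ≤ C) (v : E) : ‖T v‖ ≤ C * ‖v‖ := by
  set b := hT.eigenvectorBasis rfl
  have hcoord : ∀ i, inner 𝕜 (b i) (T v) = hT.eigenvalues rfl i * inner 𝕜 (b i) v := fun i => by
    rw [← hT (b i) v, hT.apply_eigenvectorBasis rfl i, inner_smul_left, RCLike.conj_ofReal]
  refine (pow_le_pow_iff_left₀ (norm_nonneg _) (by positivity) two_ne_zero).1 ?_
  rw [mul_pow, ← b.sum_sq_norm_inner_right (T v), ← b.sum_sq_norm_inner_right v, Finset.mul_sum]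
  gcongr with i
  rw [hcoord, norm_mul, mul_pow]
  gcongr
  exact h _ (hT.hasEigenvalue_eigenvalues rfl i)

variable {E : Type*} [NormedAddCommGroup E] [InnerProductSpace ℝ E] {B : E →L[ℝ] E →L[ℝ] ℝ}

/-- The eigenvalues of a bilinear form with respect to the inner product: the scalars `l` such that
`B v = l ⟪v, ·⟫` for some `v ≠ 0`. -/
def bilinEigenvalues (B : E →L[ℝ] E →L[ℝ] ℝ) : Set ℝ :=
  {l | ∃ v : E, v ≠ 0 ∧ ∀ w, B v w = l * inner ℝ v w}

lemma le_of_mem_bilinEigenvalues {l K : ℝ} (hl : l ∈ bilinEigenvalues B)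
    (hK : ∀ v, B v v ≤ K * ‖v‖ ^ 2) : l ≤ K := by
  obtain ⟨v, hv, h⟩ := hl
  have := hK v
  rw [h v, real_inner_self_eq_norm_sq] at this
  exact le_of_mul_le_mul_right this (by positivity)

lemma ge_of_mem_bilinEigenvalues {l m : ℝ} (hl : l ∈ bilinEigenvalues B)
    (hm : ∀ v, m * ‖v‖ ^ 2 ≤ B v v) : m ≤ l := by
  obtain ⟨v, hv, h⟩ := hl
  have := hm v
  rw [h v, real_inner_self_eq_norm_sq] at this
  exact le_of_mul_le_mul_right this (by positivity)

lemma abs_le_norm_of_mem_bilinEigenvalues {l : ℝ} (hl : l ∈ bilinEigenvalues B) : |l| ≤ ‖B‖ := by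
  have hB : ∀ v, |B v v| ≤ ‖B‖ * ‖v‖ ^ 2 := fun v => by
    simpa only [Real.norm_eq_abs, mul_assoc, sq] using B.le_opNorm₂ v v
  exact abs_le.2 ⟨ge_of_mem_bilinEigenvalues hl fun v => by
    rw [neg_mul]; exact neg_le_of_abs_le (hB v),
    le_of_mem_bilinEigenvalues hl fun v => le_of_abs_le (hB v)⟩

variable [FiniteDimensional ℝ E]

lemma norm_le_of_bilinEigenvalues (hB : ∀ v w, B v w = B w v) {C : ℝ} (hC : 0 ≤ C)
    (h : ∀ l ∈ bilinEigenvalues B, |l| ≤ C) : ‖B‖ ≤ C := by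
  let T : E →ₗ[ℝ] E :=
    { toFun := fun v => (InnerProductSpace.toDual ℝ E).symm (B v)
      map_add' := fun v w => by simp only [map_add]
      map_smul' := fun c v => by simp }
  have inner_T : ∀ v w, inner ℝ (T v) w = B v w := fun v w =>
    InnerProductSpace.toDual_symm_apply
  have hsymm : T.IsSymmetric := fun v w => by
    rw [inner_T, real_inner_comm, inner_T, hB]
  have hbound : ∀ v, ‖T v‖ ≤ C * ‖v‖ := norm_apply_le_of_isSymmetric hsymm hC fun l hl => by
    obtain ⟨v, hv⟩ := hl.exists_hasEigenvector
    refine h l ⟨v, hv.2, fun w => ?_⟩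
    rw [← inner_T, hv.apply_eq_smul, real_inner_smul_left]
  refine B.opNorm_le_bound₂ hC fun v w => ?_
  rw [← inner_T]
  exact (norm_inner_le_norm _ _).trans (by gcongr; exact hbound v)

lemma norm_le_max_of_bounds (hB : ∀ v w, B v w = B w v) {K m : ℝ} (hK : 0 ≤ K)
    (hle : ∀ v, B v v ≤ K * ‖v‖ ^ 2) (hge : ∀ v, m * ‖v‖ ^ 2 ≤ B v v) : ‖B‖ ≤ max K (-m) :=
  norm_le_of_bilinEigenvalues hB (le_max_of_le_left hK) fun _ hl => abs_le'.2
    ⟨le_max_of_le_left (le_of_mem_bilinEigenvalues hl hle),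
      le_max_of_le_right (neg_le_neg (ge_of_mem_bilinEigenvalues hl hge))⟩

lemma max_sSup_neg_sInf_bilinEigenvalues (hB : ∀ v w, B v w = B w v) :
    max (sSup (bilinEigenvalues B)) (-sInf (bilinEigenvalues B)) = ‖B‖ := by
  have hbounds : ∀ l ∈ bilinEigenvalues B, -‖B‖ ≤ l ∧ l ≤ ‖B‖ := fun l hl =>
    abs_le.1 (abs_le_norm_of_mem_bilinEigenvalues hl)
  refine le_antisymm (max_le ?_ ?_) ?_
  · exact Real.sSup_le (fun l hl => (hbounds l hl).2) (norm_nonneg B)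
  · exact neg_le.2 (Real.le_sInf (fun l hl => (hbounds l hl).1) (neg_nonpos.2 (norm_nonneg B)))
  have hsup : ∀ l ∈ bilinEigenvalues B, l ≤ sSup (bilinEigenvalues B) := fun l hl =>
    le_csSup ⟨‖B‖, fun l hl => (hbounds l hl).2⟩ hl
  have hinf : ∀ l ∈ bilinEigenvalues B, sInf (bilinEigenvalues B) ≤ l := fun l hl =>
    csInf_le ⟨-‖B‖, fun l hl => (hbounds l hl).1⟩ hl
  have habs : ∀ l ∈ bilinEigenvalues B,
      |l| ≤ max (sSup (bilinEigenvalues B)) (-sInf (bilinEigenvalues B)) := fun l hl =>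
    abs_le'.2 ⟨le_max_of_le_left (hsup l hl), le_max_of_le_right (neg_le_neg (hinf l hl))⟩
  refine norm_le_of_bilinEigenvalues hB ?_ habs
  rcases (bilinEigenvalues B).eq_empty_or_nonempty with hempty | ⟨l, hl⟩
  · simp [hempty]
  · exact (abs_nonneg l).trans (habs l hl)

end Spectrum

section Hessian

variable {d₀ d₁ : ℕ} {f : FrobMatrix d₀ d₁ → ℝ}

lemma second_fderiv_symm (hf : ContDiff ℝ 2 f) (A B C : FrobMatrix d₀ d₁) :
    fderiv ℝ (fderiv ℝ f) A B C = fderiv ℝ (fderiv ℝ f) A C B :=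
  (hf.contDiffAt.isSymmSndFDerivAt (by simp)).eq B C

lemma max_hessianEigenvalue_eq_norm (hf : ContDiff ℝ 2 f) (A : FrobMatrix d₀ d₁) :
    max (hessianMaxEigenvalue f A) (-hessianMinEigenvalue f A) =
      ‖fderiv ℝ (fderiv ℝ f) A‖ :=
  max_sSup_neg_sInf_bilinEigenvalues (second_fderiv_symm hf A)

lemma weaklyConvex_iff_strongConvexOn {ρ : ℝ} :
    WeaklyConvex ρ f ↔ StrongConvexOn univ (-ρ) f := by
  simp only [WeaklyConvex, strongConvexOn_iff_convex, neg_div, neg_mul, sub_neg_eq_add]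

lemma lSmoothOn_of_norm_le (hf : ContDiff ℝ 2 f) {s : Set (FrobMatrix d₀ d₁)} (hs : Convex ℝ s)
    {L : ℝ} (hL : ∀ A ∈ s, ‖fderiv ℝ (fderiv ℝ f) A‖ ≤ L) : LSmoothOn L f s := by
  have hf' : ContDiff ℝ 1 (fderiv ℝ f) := hf.fderiv_right (by norm_num)
  refine ⟨fun A _ => hf.differentiable two_ne_zero A, fun A hA B hB => ?_⟩
  rw [gradient, gradient, ← map_sub, LinearIsometryEquiv.norm_map]
  exact hs.norm_image_sub_le_of_norm_fderiv_le (fun C _ => hf'.differentiable one_ne_zero C)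
    hL hB hA

lemma frobBall_eq_closedBall (M : ℝ) : frobBall d₀ d₁ M = Metric.closedBall 0 (M / 2) := by
  ext A
  simp [frobBall]

lemma exists_isGreatest_and_lSmoothOn (hf : ContDiff ℝ 2 f) {M : ℝ} (hM : 0 ≤ M) :
    ∃ A₀ ∈ frobBall d₀ d₁ M,
      IsGreatest ((fun A => max (hessianMaxEigenvalue f A) (-hessianMinEigenvalue f A)) ''
        frobBall d₀ d₁ M) ‖fderiv ℝ (fderiv ℝ f) A₀‖ ∧
      LSmoothOn ‖fderiv ℝ (fderiv ℝ f) A₀‖ f (frobBall d₀ d₁ M) := by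
  have hcont : Continuous fun A => ‖fderiv ℝ (fderiv ℝ f) A‖ :=
    ((hf.fderiv_right (m := 1) (by norm_num)).continuous_fderiv one_ne_zero).norm
  simp only [max_hessianEigenvalue_eq_norm hf, frobBall_eq_closedBall]
  obtain ⟨A₀, hA₀, hmax⟩ := (isCompact_closedBall (0 : FrobMatrix d₀ d₁) (M / 2)).exists_isMaxOn
    (Metric.nonempty_closedBall.2 (by positivity)) hcont.continuousOn
  exact ⟨A₀, hA₀, ⟨mem_image_of_mem _ hA₀, forall_mem_image.2 hmax⟩,
    lSmoothOn_of_norm_le hf (convex_closedBall _ _) hmax⟩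

end Hessian

section PenalizedValue

variable {Z E : Type*} [TopologicalSpace Z] [NormedAddCommGroup E] [InnerProductSpace ℝ E]

/-- The continuous linear map `A ↦ ⟪A, T ·⟫`, for a bounded continuous function `T`. -/
noncomputable def innerLeft (T : Z →ᵇ E) : E →L[ℝ] (Z →ᵇ ℝ) :=
  LinearMap.mkContinuous
    { toFun := fun A => (innerSL ℝ A).compLeftContinuousBounded Z T
      map_add' := fun A B => by ext z; simp
      map_smul' := fun c A => by ext z; simp }
    ‖T‖ fun A => (norm_le (by positivity)).2 fun z => by
      calc ‖inner ℝ A (T z)‖ ≤ ‖A‖ * ‖T z‖ := norm_inner_le_norm _ _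
        _ ≤ ‖A‖ * ‖T‖ := by gcongr; exact T.norm_coe_le_norm z
        _ = ‖T‖ * ‖A‖ := mul_comm _ _

lemma integral_innerLeft_sq_le [MeasurableSpace Z] [OpensMeasurableSpace Z] (π : Measure Z)
    [IsFiniteMeasure π] (T : Z →ᵇ E) (A : E) :
    ∫ z, innerLeft T A z ^ 2 ∂π ≤ ‖A‖ ^ 2 * ∫ z, ‖T z‖ ^ 2 ∂π := by
  have hT : Integrable (fun z => ‖T z‖ ^ 2) π := (T.normComp ^ 2).integrable π
  rw [← integral_const_mul]
  refine integral_mono ((innerLeft T A ^ 2).integrable π) (hT.const_mul _) fun z => ?_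
  change inner ℝ A (T z) ^ 2 ≤ ‖A‖ ^ 2 * ‖T z‖ ^ 2
  rw [← mul_pow]
  exact sq_le_sq.2 ((abs_real_inner_le_norm A (T z)).trans (le_abs_self _))

lemma hasDerivAt_norm_sq_line (x v : E) (t : ℝ) :
    HasDerivAt (fun s : ℝ => ‖x + s • v‖ ^ 2) (2 * inner ℝ (x + t • v) v) t :=
  (hasDerivAt_line x v t).norm_sq

lemma hasDerivAt_inner_line (x v : E) (t : ℝ) :
    HasDerivAt (fun s : ℝ => 2 * inner ℝ (x + s • v) v) (2 * ‖v‖ ^ 2) t := by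
  simpa using ((hasDerivAt_line x v t).inner ℝ (hasDerivAt_const t v)).const_mul 2

variable {X Y : Type*} [TopologicalSpace X] [TopologicalSpace Y]
  [MeasurableSpace X] [MeasurableSpace Y] [OpensMeasurableSpace X] [OpensMeasurableSpace Y]
  {μ : Measure X} {ν : Measure Y} [IsProbabilityMeasure μ] [IsProbabilityMeasure ν]
  {κ ε : ℝ} {a : X × Y →ᵇ ℝ} {T : X × Y →ᵇ E}

variable [SecondCountableTopology Y]

variable (μ ν) in
/-- The dual value along the affine family of log-kernels `a + ⟪A, T ·⟫`, multiplied by `ε` and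
penalised by `κ ‖A‖²`. -/
noncomputable def penalizedValue (κ ε : ℝ) (a : X × Y →ᵇ ℝ) (T : X × Y →ᵇ E) (A : E) : ℝ :=
  κ * ‖A‖ ^ 2 + ε * dualValue μ ν (a + innerLeft T A)

lemma penalizedValue_line (A B : E) (t : ℝ) :
    penalizedValue μ ν κ ε a T (A + t • B) =
      κ * ‖A + t • B‖ ^ 2 + ε * dualValue μ ν (a + innerLeft T A + t • innerLeft T B) := by
  rw [penalizedValue, map_add, map_smul, add_assoc]

variable [SecondCountableTopology X]

lemma contDiff_penalizedValue {n : WithTop ℕ∞} (hn : n ≠ 0) :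
    ContDiff ℝ n (penalizedValue μ ν κ ε a T) :=
  (contDiff_const.mul (contDiff_norm_sq ℝ)).add
    (contDiff_const.mul ((contDiff_dualValue μ ν hn).comp
      (contDiff_const.add (innerLeft T).contDiff)))

lemma second_fderiv_penalizedValue_le (hε : 0 ≤ ε) (A B : E) :
    fderiv ℝ (fderiv ℝ (penalizedValue μ ν κ ε a T)) A B B ≤ 2 * κ * ‖B‖ ^ 2 := by
  obtain ⟨p, h⟩ := exists_isSchrodingerPair μ ν (a + innerLeft T A)
  let V := dualValue μ ν (a + innerLeft T A)
  let s := mean (gibbsPlan μ ν (a + innerLeft T A) p) (innerLeft T B)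
  refine second_fderiv_le_of_le_on_line (contDiff_penalizedValue two_ne_zero)
    (g := fun t => κ * ‖A + t • B‖ ^ 2 + ε * (V - t * s))
    (g' := fun t => κ * (2 * inner ℝ (A + t • B) B) + ε * -s) (fun t => ?_) ?_ (fun t => ?_) ?_
  · rw [penalizedValue_line]
    gcongr
    simpa only [map_smul, smul_eq_mul] using h.dualValue_add_le (t • innerLeft T B)
  · simp [penalizedValue, V]
  · have hlin : HasDerivAt (fun t => V - t * s) (-s) t := by
      simpa using ((hasDerivAt_id' t).mul_const s).const_sub V
    exact ((hasDerivAt_norm_sq_line A B t).const_mul κ).fun_add (hlin.const_mul ε)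
  · refine (((hasDerivAt_inner_line A B 0).const_mul κ).add_const (ε * -s)).congr_deriv ?_
    ring

lemma le_second_fderiv_penalizedValue (hε : 0 ≤ ε) {K : ℝ}
    (hK : ∀ π ∈ couplings μ ν, ∫ z, ‖T z‖ ^ 2 ∂π ≤ K) (A B : E) :
    (2 * κ - ε * K) * ‖B‖ ^ 2 ≤ fderiv ℝ (fderiv ℝ (penalizedValue μ ν κ ε a T)) A B B := by
  obtain ⟨p, h⟩ := exists_isSchrodingerPair μ ν (a + innerLeft T A)
  let V := dualValue μ ν (a + innerLeft T A)
  let π := gibbsPlan μ ν (a + innerLeft T A) p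
  let w := innerLeft T B
  have hle : κ * (2 * ‖B‖ ^ 2) - ε * ∫ z, w z ^ 2 ∂π ≤
      fderiv ℝ (fderiv ℝ (penalizedValue μ ν κ ε a T)) A B B := by
    refine le_second_fderiv_of_le_on_line (contDiff_penalizedValue two_ne_zero)
      (g := fun t => κ * ‖A + t • B‖ ^ 2 + ε * (V + 1 - ∫ z, Real.exp (t * w z) ∂π))
      (g' := fun t => κ * (2 * inner ℝ (A + t • B) B) + ε * -∫ z, w z * Real.exp (t * w z) ∂π)
      (fun t => ?_) ?_ (fun t => ?_) ?_
    · rw [penalizedValue_line]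
      gcongr
      exact h.le_dualValue_add (t • w)
    · simp [penalizedValue, V]
    · have hexp := (hasDerivAt_integral_exp (π := π) (w := w) (t := t)).const_sub (V + 1)
      exact ((hasDerivAt_norm_sq_line A B t).const_mul κ).fun_add (hexp.const_mul ε)
    · have hexp := (hasDerivAt_integral_mul_exp (π := π) (w := w) (t := 0)).fun_neg.const_mul ε
      refine (((hasDerivAt_inner_line A B 0).const_mul κ).fun_add hexp).congr_deriv ?_
      simp only [zero_mul, Real.exp_zero, mul_one, mul_neg, sub_eq_add_neg]
  have hsq : ∫ z, w z ^ 2 ∂π ≤ ‖B‖ ^ 2 * K :=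
    (integral_innerLeft_sq_le π T B).trans (by gcongr; exact hK π h.gibbsPlan_mem_couplings)
  linarith [mul_le_mul_of_nonneg_left hsq hε]

lemma tendsto_penalizedValue_cocompact [FiniteDimensional ℝ E] (hκ : 0 < κ) (hε : 0 ≤ ε) :
    Tendsto (penalizedValue μ ν κ ε a T) (cocompact E) atTop := by
  have hle : ∀ A, ‖A‖ * (κ * ‖A‖ - ε * ‖innerLeft T‖) - ε * ‖a‖ ≤
      penalizedValue μ ν κ ε a T A := fun A => by
    have hnorm : ‖a + innerLeft T A‖ ≤ ‖a‖ + ‖innerLeft T‖ * ‖A‖ :=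
      (norm_add_le _ _).trans (by gcongr; exact (innerLeft T).le_opNorm A)
    have hvalue : -(‖a‖ + ‖innerLeft T‖ * ‖A‖) ≤ dualValue μ ν (a + innerLeft T A) :=
      (neg_le_neg hnorm).trans neg_norm_le_dualValue
    rw [penalizedValue]
    linarith [mul_le_mul_of_nonneg_left hvalue hε]
  have hnorm : Tendsto (fun A : E => ‖A‖) (cocompact E) atTop := tendsto_norm_cocompact_atTop
  exact tendsto_atTop_mono hle (tendsto_atTop_add_const_right _ _
    (hnorm.atTop_mul_atTop₀ (tendsto_atTop_add_const_right _ _ (hnorm.const_mul_atTop hκ))))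

end PenalizedValue

section CompactSupport

variable {X F : Type*} [TopologicalSpace X] [NormedAddCommGroup F]

lemma exists_boundedContinuous_eqOn [R1Space X] [LocallyCompactSpace X] [NormedSpace ℝ F]
    {f : X → F} (hf : Continuous f) {K : Set X} (hK : IsCompact K) :
    ∃ T : X →ᵇ F, EqOn T f K := by
  obtain ⟨χ, hχK, hχ, -, -⟩ :=
    exists_continuousMap_one_of_isCompact_subset_isOpen hK isOpen_univ (subset_univ K)
  have hcont : Continuous fun x => χ x • f x := χ.continuous.smul hf
  obtain ⟨C, hC⟩ := (HasCompactSupport.smul_right (f' := f) hχ).exists_bound_of_continuous hcont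
  exact ⟨ofNormedAddCommGroup _ hcont C hC, fun x hx => by simp [hχK hx]⟩

variable [MeasurableSpace X] [OpensMeasurableSpace X] [SecondCountableTopology X]

lemma memLp_of_isCompact_support {μ : Measure X} [IsFiniteMeasure μ]
    (hμ : IsCompact μ.support) {f : X → F} (hf : Continuous f) (p : ENNReal) : MemLp f p μ := by
  obtain ⟨C, hC⟩ := hμ.exists_bound_of_continuousOn hf.continuousOn
  exact .of_bound hf.aestronglyMeasurable C (by
    filter_upwards [Measure.support_mem_ae] with x hx using hC x hx)

end CompactSupport

section CouplingMoments

variable {X Y : Type*} [MeasurableSpace X] [MeasurableSpace Y] {μ : Measure X} {ν : Measure Y}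
  {π : Measure (X × Y)}

lemma ae_of_mem_couplings (hπ : π ∈ couplings μ ν) {s : Set X} {t : Set Y} (hs : s ∈ ae μ)
    (ht : t ∈ ae ν) : ∀ᵐ z ∂π, z ∈ s ×ˢ t := by
  obtain ⟨rfl, rfl⟩ := hπ
  filter_upwards [ae_of_ae_map measurable_fst.aemeasurable hs,
    ae_of_ae_map measurable_snd.aemeasurable ht] with z hz₁ hz₂ using ⟨hz₁, hz₂⟩

lemma integral_mul_le_sqrt_of_mem_couplings (hπ : π ∈ couplings μ ν) {f : X → ℝ} {g : Y → ℝ}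
    (hf₀ : 0 ≤ f) (hg₀ : 0 ≤ g) (hf : MemLp f 2 μ) (hg : MemLp g 2 ν) :
    ∫ z, f z.1 * g z.2 ∂π ≤ √((∫ x, f x ^ 2 ∂μ) * ∫ y, g y ^ 2 ∂ν) := by
  have hf' : MemLp (fun z : X × Y => f z.1) 2 π :=
    hf.comp_measurePreserving ⟨measurable_fst, hπ.1⟩
  have hg' : MemLp (fun z : X × Y => g z.2) 2 π :=
    hg.comp_measurePreserving ⟨measurable_snd, hπ.2⟩
  have hholder := integral_mul_le_Lp_mul_Lq_of_nonneg Real.HolderConjugate.two_two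
    (.of_forall fun z : X × Y => hf₀ z.1) (.of_forall fun z : X × Y => hg₀ z.2)
    (by simpa using hf') (by simpa using hg')
  simp only [Real.rpow_two, ← Real.sqrt_eq_rpow] at hholder
  rwa [← Real.sqrt_mul (by positivity),
    integral_fst_of_mem_couplings hπ (f := fun x => f x ^ 2) (hf.1.pow 2),
    integral_snd_of_mem_couplings hπ (f := fun y => g y ^ 2) (hg.1.pow 2)] at hholder

end CouplingMoments

section Cost

variable {d₀ d₁ : ℕ}

/-- The matrix `x yᵀ`. -/
def outer (x : EuclideanSpace ℝ (Fin d₀)) (y : EuclideanSpace ℝ (Fin d₁)) : FrobMatrix d₀ d₁ :=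
  WithLp.toLp 2 fun p => x p.1 * y p.2

lemma continuous_outer :
    Continuous fun z : EuclideanSpace ℝ (Fin d₀) × EuclideanSpace ℝ (Fin d₁) => outer z.1 z.2 := by
  unfold outer
  fun_prop

lemma norm_outer (x : EuclideanSpace ℝ (Fin d₀)) (y : EuclideanSpace ℝ (Fin d₁)) :
    ‖outer x y‖ = ‖x‖ * ‖y‖ := by
  rw [EuclideanSpace.norm_eq, EuclideanSpace.norm_eq, EuclideanSpace.norm_eq,
    ← Real.sqrt_mul (by positivity), Finset.sum_mul_sum, Fintype.sum_prod_type]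
  simp [outer, mul_pow]

lemma costMatrix_eq (A : FrobMatrix d₀ d₁) (x : EuclideanSpace ℝ (Fin d₀))
    (y : EuclideanSpace ℝ (Fin d₁)) :
    costMatrix A x y = -4 * ‖outer x y‖ ^ 2 - 32 * inner ℝ A (outer x y) := by
  have hinner : inner ℝ A (outer x y) = ∑ i, ∑ j, x i * A (i, j) * y j := by
    rw [PiLp.inner_apply, Fintype.sum_prod_type]
    refine Finset.sum_congr rfl fun i _ => Finset.sum_congr rfl fun j _ => ?_
    simp only [outer, RCLike.inner_apply, conj_trivial]
    ring
  rw [costMatrix, norm_outer, hinner]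
  ring

variable {μ₀ : Measure (EuclideanSpace ℝ (Fin d₀))} {μ₁ : Measure (EuclideanSpace ℝ (Fin d₁))}

lemma integral_norm_outer_sq_le [IsFiniteMeasure μ₀] [IsFiniteMeasure μ₁]
    (hμ₀ : IsCompact μ₀.support) (hμ₁ : IsCompact μ₁.support)
    {π : Measure (EuclideanSpace ℝ (Fin d₀) × EuclideanSpace ℝ (Fin d₁))}
    (hπ : π ∈ couplings μ₀ μ₁) :
    ∫ z, ‖outer z.1 z.2‖ ^ 2 ∂π ≤ √(fourthMoment μ₀ * fourthMoment μ₁) := by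
  have := integral_mul_le_sqrt_of_mem_couplings hπ (fun x => sq_nonneg ‖x‖) (fun y => sq_nonneg ‖y‖)
    (memLp_of_isCompact_support hμ₀ (by fun_prop) 2)
    (memLp_of_isCompact_support hμ₁ (by fun_prop) 2)
  simpa only [fourthMoment, norm_outer, mul_pow, ← pow_mul, Nat.reduceMul] using this

lemma exists_boundedContinuous_ae_eq_outer (hμ₀ : IsCompact μ₀.support)
    (hμ₁ : IsCompact μ₁.support) :
    ∃ T : EuclideanSpace ℝ (Fin d₀) × EuclideanSpace ℝ (Fin d₁) →ᵇ FrobMatrix d₀ d₁,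
      ∀ π ∈ couplings μ₀ μ₁, ∀ᵐ z ∂π, T z = outer z.1 z.2 := by
  obtain ⟨T, hT⟩ := exists_boundedContinuous_eqOn continuous_outer (hμ₀.prod hμ₁)
  refine ⟨T, fun π hπ => ?_⟩
  filter_upwards [ae_of_mem_couplings hπ Measure.support_mem_ae Measure.support_mem_ae] with z hz
    using hT hz

end Cost

section Objective

variable {d₀ d₁ : ℕ} {μ₀ : Measure (EuclideanSpace ℝ (Fin d₀))}
  {μ₁ : Measure (EuclideanSpace ℝ (Fin d₁))} [IsProbabilityMeasure μ₀] [IsProbabilityMeasure μ₁]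
  {ε : ℝ}

lemma exists_matrixOT_eq (hμ₀ : IsCompact μ₀.support) (hμ₁ : IsCompact μ₁.support) (hε : 0 < ε) :
    ∃ (a : EuclideanSpace ℝ (Fin d₀) × EuclideanSpace ℝ (Fin d₁) →ᵇ ℝ)
      (T : EuclideanSpace ℝ (Fin d₀) × EuclideanSpace ℝ (Fin d₁) →ᵇ FrobMatrix d₀ d₁),
      (∀ A, matrixOT ε μ₀ μ₁ A = ((ε * dualValue μ₀ μ₁ (a + innerLeft T A) : ℝ) : EReal)) ∧
      ∀ π ∈ couplings μ₀ μ₁, ∫ z, ‖T z‖ ^ 2 ∂π ≤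
        (32 * ε⁻¹) ^ 2 * √(fourthMoment μ₀ * fourthMoment μ₁) := by
  obtain ⟨T, hT⟩ := exists_boundedContinuous_ae_eq_outer hμ₀ hμ₁
  refine ⟨(4 * ε⁻¹) • T.normComp ^ 2, (32 * ε⁻¹) • T, fun A => ?_, fun π hπ => ?_⟩
  · refine entropicOT_eq_dualValue hε ?_
    filter_upwards [hT _ ⟨Measure.fst_prod, Measure.snd_prod⟩] with z hz
    change _ = -ε * (4 * ε⁻¹ * ‖T z‖ ^ 2 + inner ℝ A ((32 * ε⁻¹) • T z))
    rw [costMatrix_eq, hz, real_inner_smul_right]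
    field_simp
    ring
  · calc ∫ z, ‖(32 * ε⁻¹) • T z‖ ^ 2 ∂π
        = ∫ z, (32 * ε⁻¹) ^ 2 * ‖outer z.1 z.2‖ ^ 2 ∂π := by
          refine integral_congr_ae ?_
          filter_upwards [hT π hπ] with z hz
          rw [hz, norm_smul, mul_pow, Real.norm_eq_abs, sq_abs]
      _ = (32 * ε⁻¹) ^ 2 * ∫ z, ‖outer z.1 z.2‖ ^ 2 ∂π := integral_const_mul _ _
      _ ≤ (32 * ε⁻¹) ^ 2 * √(fourthMoment μ₀ * fourthMoment μ₁) := by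
          gcongr
          exact integral_norm_outer_sq_le hμ₀ hμ₁ hπ

lemma matrixOT_ne_top_and_ne_bot (hμ₀ : IsCompact μ₀.support) (hμ₁ : IsCompact μ₁.support)
    (hε : 0 < ε) (A : FrobMatrix d₀ d₁) : matrixOT ε μ₀ μ₁ A ≠ ⊤ ∧ matrixOT ε μ₀ μ₁ A ≠ ⊥ := by
  obtain ⟨a, T, hOT, -⟩ := exists_matrixOT_eq hμ₀ hμ₁ hε
  exact hOT A ▸ ⟨EReal.coe_ne_top _, EReal.coe_ne_bot _⟩

lemma exists_objective_eq (hμ₀ : IsCompact μ₀.support) (hμ₁ : IsCompact μ₁.support)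
    (hε : 0 < ε) :
    ∃ (a : EuclideanSpace ℝ (Fin d₀) × EuclideanSpace ℝ (Fin d₁) →ᵇ ℝ)
      (T : EuclideanSpace ℝ (Fin d₀) × EuclideanSpace ℝ (Fin d₁) →ᵇ FrobMatrix d₀ d₁),
      objective ε μ₀ μ₁ = penalizedValue μ₀ μ₁ 32 ε a T ∧
      ∀ π ∈ couplings μ₀ μ₁, ∫ z, ‖T z‖ ^ 2 ∂π ≤
        (32 * ε⁻¹) ^ 2 * √(fourthMoment μ₀ * fourthMoment μ₁) := by
  obtain ⟨a, T, hOT, hT⟩ := exists_matrixOT_eq hμ₀ hμ₁ hε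
  refine ⟨a, T, funext fun A => ?_, hT⟩
  rw [objective, hOT, EReal.toReal_coe, penalizedValue]

lemma contDiff_objective (hμ₀ : IsCompact μ₀.support) (hμ₁ : IsCompact μ₁.support) (hε : 0 < ε)
    {n : WithTop ℕ∞} (hn : n ≠ 0) : ContDiff ℝ n (objective ε μ₀ μ₁) := by
  obtain ⟨a, T, hΦ, -⟩ := exists_objective_eq hμ₀ hμ₁ hε
  exact hΦ ▸ contDiff_penalizedValue hn

lemma tendsto_objective_cocompact (hμ₀ : IsCompact μ₀.support) (hμ₁ : IsCompact μ₁.support)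
    (hε : 0 < ε) : Tendsto (objective ε μ₀ μ₁) (cocompact _) atTop := by
  obtain ⟨a, T, hΦ, -⟩ := exists_objective_eq hμ₀ hμ₁ hε
  exact hΦ ▸ tendsto_penalizedValue_cocompact (by norm_num) hε.le

lemma second_fderiv_objective_le (hμ₀ : IsCompact μ₀.support) (hμ₁ : IsCompact μ₁.support)
    (hε : 0 < ε) (A B : FrobMatrix d₀ d₁) :
    fderiv ℝ (fderiv ℝ (objective ε μ₀ μ₁)) A B B ≤ 64 * ‖B‖ ^ 2 := by
  obtain ⟨a, T, hΦ, -⟩ := exists_objective_eq hμ₀ hμ₁ hε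
  rw [hΦ]
  exact (second_fderiv_penalizedValue_le hε.le A B).trans_eq (by norm_num)

lemma le_second_fderiv_objective (hμ₀ : IsCompact μ₀.support) (hμ₁ : IsCompact μ₁.support)
    (hε : 0 < ε) (A B : FrobMatrix d₀ d₁) :
    -(32 ^ 2 * ε⁻¹ * √(fourthMoment μ₀ * fourthMoment μ₁) - 64) * ‖B‖ ^ 2 ≤
      fderiv ℝ (fderiv ℝ (objective ε μ₀ μ₁)) A B B := by
  obtain ⟨a, T, hΦ, hT⟩ := exists_objective_eq hμ₀ hμ₁ hε
  rw [hΦ]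
  convert le_second_fderiv_penalizedValue hε.le hT A B using 2
  field_simp
  ring

lemma existsUnique_minimizer_objective (hμ₀ : IsCompact μ₀.support)
    (hμ₁ : IsCompact μ₁.support) (hε : 0 < ε)
    (hconv : StrictConvexOn ℝ univ (objective ε μ₀ μ₁)) :
    ∃! A, ∀ B, objective ε μ₀ μ₁ A ≤ objective ε μ₀ μ₁ B := by
  obtain ⟨A, hA⟩ := (contDiff_objective hμ₀ hμ₁ hε one_ne_zero).continuous.exists_forall_le
    (tendsto_objective_cocompact hμ₀ hμ₁ hε)
  exact ⟨A, hA, fun B hB => hconv.eq_of_isMinOn (fun C _ => hB C) (fun C _ => hA C)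
    (mem_univ B) (mem_univ A)⟩

end Objective

end EntropicOT

open EntropicOT

theorem theorem1 (d₀ d₁ : ℕ)
    (μ₀ : Measure (EuclideanSpace ℝ (Fin d₀))) (μ₁ : Measure (EuclideanSpace ℝ (Fin d₁)))
    [IsProbabilityMeasure μ₀] [IsProbabilityMeasure μ₁]
    (hμ₀ : IsCompact μ₀.support) (hμ₁ : IsCompact μ₁.support)
    (ε : ℝ) (hε : 0 < ε) :
    -- `Φ` is real-valued and twice continuously differentiable
    (∀ A, matrixOT ε μ₀ μ₁ A ≠ ⊤ ∧ matrixOT ε μ₀ μ₁ A ≠ ⊥) ∧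
    ContDiff ℝ 2 (objective ε μ₀ μ₁) ∧
    WeaklyConvex (32 ^ 2 * ε⁻¹ * √(fourthMoment μ₀ * fourthMoment μ₁) - 64)
      (objective ε μ₀ μ₁) ∧
    (√(fourthMoment μ₀ * fourthMoment μ₁) < ε / 16 →
      StrictConvexOn ℝ univ (objective ε μ₀ μ₁) ∧
      ∃! A, ∀ B, objective ε μ₀ μ₁ A ≤ objective ε μ₀ μ₁ B) ∧
    ∀ M : ℝ, 0 < M → ∃ L : ℝ,
      IsGreatest ((fun A => max (hessianMaxEigenvalue (objective ε μ₀ μ₁) A)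
        (-hessianMinEigenvalue (objective ε μ₀ μ₁) A)) '' frobBall d₀ d₁ M) L ∧
      LSmoothOn L (objective ε μ₀ μ₁) (frobBall d₀ d₁ M) ∧
      L ≤ max 64 (32 ^ 2 * ε⁻¹ * √(fourthMoment μ₀ * fourthMoment μ₁) - 64) := by
  have hsmooth := contDiff_objective hμ₀ hμ₁ hε two_ne_zero
  have hlower := le_second_fderiv_objective hμ₀ hμ₁ hε
  have hupper := second_fderiv_objective_le hμ₀ hμ₁ hε
  have hstrong := strongConvexOn_univ_of_le_second_fderiv hsmooth hlower
  refine ⟨matrixOT_ne_top_and_ne_bot hμ₀ hμ₁ hε, hsmooth,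
    weaklyConvex_iff_strongConvexOn.2 hstrong, fun hsmall => ?_, fun M hM => ?_⟩
  · have hpos : 0 < -(32 ^ 2 * ε⁻¹ * √(fourthMoment μ₀ * fourthMoment μ₁) - 64) := by
      have := mul_lt_mul_of_pos_left hsmall (by positivity : 0 < 32 ^ 2 * ε⁻¹)
      have hthreshold : 32 ^ 2 * ε⁻¹ * (ε / 16) = 64 := by
        field_simp
        norm_num
      linarith
    have hstrict := hstrong.strictConvexOn hpos
    exact ⟨hstrict, existsUnique_minimizer_objective hμ₀ hμ₁ hε hstrict⟩
  · obtain ⟨A, -, hgreatest, hlip⟩ := exists_isGreatest_and_lSmoothOn hsmooth hM.le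
    refine ⟨_, hgreatest, hlip, ?_⟩
    simpa only [neg_neg] using norm_le_max_of_bounds (second_fderiv_symm hsmooth A) (by norm_num)
      (hupper A) (hlower A)
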